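/- Let $\mathcal{G}_d=(\mathcal{V},\mathcal{E})$ be a connected, locally finite, simple graph with countably infinitely many vertices and edges, and let $\mathcal{G}$ be the metric graph obtained by assigning to each edge $e$ a length $|e|\in(0,\infty)$, identifying $e$ with $[0,|e|]$ and gluing the edges together at the vertices. Let $$H^1(\mathcal{G})=\Big\{f:\mathcal{G}\to\mathbb{C}\ \text{continuous}\ \Big|\ f|_e\in H^1(e)\ \text{for all } e\in\mathcal{E},\ \|f\|_{H^1(\mathcal{G})}^2:=\sum_{e\in\mathcal{E}}\int_e\big(|f|^2+|f'|^2\big)\,dx<\infty\Big\},$$ where $H^1(e)$ is the space of absolutely continuous functions on $e$ with derivative in $L^2(e)$. A topological end of $\mathcal{G}$ is an equivalence class of sequences $(U_n)_{n\ge0}$ of non-empty connected open subsets of $\mathcal{G}$ with compact boundaries such that $U_{n+1}\subseteq U_n$ for all $n$ and $\bigcap_n\overline{U_n}=\varnothing$; two sequences are equivalent if each member of either one contains a member of the other. Let $\mathfrak{C}(\mathcal{G})$ be the set of topological ends. The end compactification is $\widehat{\mathcal{G}}=\mathcal{G}\cup\mathfrak{C}(\mathcal{G})$, with the topology whose basis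 consists of the sets $\widehat U=U\cup\{\gamma\in\mathfrak{C}(\mathcal{G}) : \text{some } (U_n)\in\gamma \text{ has } U_0\subseteq U\}$, $U\subseteq\mathcal{G}$ open. A ray is a sequence $(v_n)_{n\ge0}$ of distinct vertices with $v_n$ adjacent to $v_{n+1}$ for all $n$; it is identified with the union of its edges. Two rays are equivalent if a third ray contains infinitely many vertices of both, and a graph end is an equivalence class of rays. The graph end $\omega_\gamma$ corresponding to $\gamma\in\mathfrak{C}(\mathcal{G})$ is the one such that, for every $(U_n)\in\gamma$, each $U_n$ contains a ray from $\omega_\gamma$. Then each $f\in H^1(\mathcal{G})$ has a unique continuous extension, again denoted by $f$, to $\widehat{\mathcal{G}}$, and its values at the ends are $$f(\gamma)=\lim_{n\to\infty}f(v_n)\qquad\text{for every } \gamma\in\mathfrak{C}(\mathcal{G}) \text{ and every ray } (v_n)_{n\ge0}\in\omega_\gamma .$$ Moreover, $$\|f\|_\infty:=\sup_{x\in\mathcal{G}}|f(x)|=\sup_{x\in\widehat{\mathcal{G}}}|f(x)|\le C_{\mathcal{G}}\,\|f\|_{H^1(\mathcal{G})},\qquad C_{\mathcal{G}}=\sqrt{\coth\big(\tfrac12\operatorname{diam}(\mathcal{G})\big)},$$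 where $\operatorname{diam}(\mathcal{G})\in(0,\infty]$ is the supremum of the lengths (sums of edge lengths) of all paths without self-intersections in $\mathcal{G}_d$, and $\coth\infty=1$. -/

import Mathlib

open MeasureTheory Filter Topology
open scoped ENNReal

/-- A metric graph: a simple graph, a finite positive length for every edge and, in order to
identify an edge `e` with the interval `[0, |e|]`, a direction of every edge. Connectedness, local
finiteness and countable infiniteness are hypotheses of the theorem. -/
structure MetricGraph (V : Type*) where
  /-- the underlying combinatorial graph -/
  graph : SimpleGraph V
  /-- the edge lengths -/
  len : graph.edgeSet → ℝ
  len_pos : ∀ e, 0 < len e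
  /-- initial vertex of an edge -/
  src : graph.edgeSet → V
  /-- terminal vertex of an edge -/
  tgt : graph.edgeSet → V
  ends : ∀ e, s(src e, tgt e) = e.1

/-- A ray in a simple graph: an infinite sequence of distinct, consecutively adjacent vertices. -/
structure GraphRay {V : Type*} (G : SimpleGraph V) where
  /-- the vertices of the ray -/
  vert : ℕ → V
  injective : Function.Injective vert
  adj : ∀ n, G.Adj (vert n) (vert (n + 1))

namespace GraphRay

variable {V : Type*} {G : SimpleGraph V}

/-- Two rays are equivalent if a third ray contains infinitely many vertices of both. -/
def Equivalent (R₁ R₂ : GraphRay G) : Prop :=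
  ∃ R₃ : GraphRay G,
    (Set.range R₃.vert ∩ Set.range R₁.vert).Infinite ∧
    (Set.range R₃.vert ∩ Set.range R₂.vert).Infinite

/-- The `n`-th edge of a ray. -/
def edge (R : GraphRay G) (n : ℕ) : G.edgeSet :=
  ⟨s(R.vert n, R.vert (n + 1)), R.adj n⟩

end GraphRay

/-- The graph ends of `G`: equivalence classes of rays. -/
def GraphEnd {V : Type*} (G : SimpleGraph V) : Type _ :=
  Quot (GraphRay.Equivalent (G := G))

/-- The ray `R` belongs to the graph end `ω`. -/
def GraphRay.BelongsTo {V : Type*} {G : SimpleGraph V} (R : GraphRay G) (ω : GraphEnd G) : Prop :=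
  Quot.mk _ R = ω

namespace MetricGraph

variable {V : Type*} (M : MetricGraph V)

/-- The points of the metric graph: the vertices, and the interior points of the edges. -/
inductive Point : Type _
  | vertex (v : V) : Point
  | inner (e : M.graph.edgeSet) (t : Set.Ioo (0 : ℝ) (M.len e)) : Point

open Classical in
/-- The point of the edge `e` with coordinate `t ∈ [0, |e|]`; the endpoints `0` and `|e|` are
glued to the initial and the terminal vertex. (Values of `t` outside `[0, |e|]` are sent to the
nearest endpoint.) -/
noncomputable def edgePt (e : M.graph.edgeSet) (t : ℝ) : M.Point :=
  if h₀ : t ≤ 0 then .vertex (M.src e)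
  else if h₁ : M.len e ≤ t then .vertex (M.tgt e)
  else .inner e ⟨t, not_le.1 h₀, not_le.1 h₁⟩

/-- The topology of the edges `[0, |e|]` glued together at the vertices: a set is open iff its
trace on every edge `[0, |e|]` is open. -/
noncomputable instance : TopologicalSpace M.Point :=
  ⨆ e : M.graph.edgeSet,
    TopologicalSpace.coinduced (fun t : Set.Icc (0 : ℝ) (M.len e) => M.edgePt e t) inferInstance

/-! ### Ends -/

/-- Decreasing sequences of nonempty connected open sets with compact boundaries, whose closures
have empty intersection. -/
structure EndSeq where
  /-- the members of the sequence -/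
  U : ℕ → Set M.Point
  isOpen : ∀ n, IsOpen (U n)
  isConnected : ∀ n, IsConnected (U n)
  isCompact_frontier : ∀ n, IsCompact (frontier (U n))
  decreasing : ∀ n, U (n + 1) ⊆ U n
  iInter_closure : ⋂ n, closure (U n) = ∅

/-- Two sequences are equivalent if each member of either one contains a member of the other. -/
instance endSetoid : Setoid M.EndSeq where
  r s s' := ∀ n, (∃ j, s'.U j ⊆ s.U n) ∧ ∃ k, s.U k ⊆ s'.U n
  iseqv :=
    { refl := fun _ n => ⟨⟨n, subset_rfl⟩, ⟨n, subset_rfl⟩⟩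
      symm := fun h n => ⟨(h n).2, (h n).1⟩
      trans := by
        intro a b c h h' n
        refine ⟨?_, ?_⟩
        · obtain ⟨j, hj⟩ := (h n).1
          obtain ⟨k, hk⟩ := (h' j).1
          exact ⟨k, hk.trans hj⟩
        · obtain ⟨j, hj⟩ := (h' n).2
          obtain ⟨k, hk⟩ := (h j).2
          exact ⟨k, hk.trans hj⟩ }

/-- The topological ends of the metric graph. -/
def TopEnd : Type _ := Quotient M.endSetoid

/-- The sequence `s` represents the topological end `γ`. -/
def EndSeq.Represents {M : MetricGraph V} (s : M.EndSeq) (γ : M.TopEnd) : Prop :=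
  Quotient.mk M.endSetoid s = γ

/-- A ray as a subset of the metric graph: the union of its closed edges. -/
def rayCarrier (R : GraphRay M.graph) : Set M.Point :=
  ⋃ n, M.edgePt (R.edge n) '' Set.Icc 0 (M.len (R.edge n))

/-- `ω` is the graph end `ω_γ` corresponding to the topological end `γ`: for every sequence
representing `γ`, each of its members contains a ray from `ω`. -/
def Corresponds (γ : M.TopEnd) (ω : GraphEnd M.graph) : Prop :=
  ∀ s : M.EndSeq, s.Represents γ →
    ∀ n, ∃ R : GraphRay M.graph, R.BelongsTo ω ∧ M.rayCarrier R ⊆ s.U n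

/-- The underlying set of the end compactification. -/
inductive EndCompactification : Type _
  | point (x : M.Point) : EndCompactification
  | topEnd (γ : M.TopEnd) : EndCompactification

/-- The extension `Û` of a set `U` of points: add all ends that are represented by a sequence
with first member inside `U`. -/
def hat (U : Set M.Point) : Set M.EndCompactification :=
  EndCompactification.point '' U ∪
    EndCompactification.topEnd '' {γ | ∃ s : M.EndSeq, s.Represents γ ∧ s.U 0 ⊆ U}

/-- The topology of the end compactification, with basis `Û`, `U` open. -/
noncomputable instance : TopologicalSpace M.EndCompactification :=
  TopologicalSpace.generateFrom {W | ∃ U : Set M.Point, IsOpen U ∧ W = M.hat U}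

/-! ### The Sobolev space -/

/-- The component `f_e` of `f` on the edge `e ≅ [0, |e|]`. -/
noncomputable def onEdge {M : MetricGraph V} (f : M.Point → ℂ) (e : M.graph.edgeSet) : ℝ → ℂ :=
  fun t => f (M.edgePt e t)

/-- `‖f‖²` in `L²`, with values in `[0, ∞]`. -/
noncomputable def sqNormL2 {M : MetricGraph V} (f : M.Point → ℂ) : ℝ≥0∞ :=
  ∑' e : M.graph.edgeSet, ∫⁻ t in Set.Ioo 0 (M.len e), ‖onEdge f e t‖ₑ ^ 2

/-- `‖f'‖²` in `L²`, with values in `[0, ∞]`, for `f` absolutely continuous on every edge. -/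
noncomputable def energy {M : MetricGraph V} (f : M.Point → ℂ) : ℝ≥0∞ :=
  ∑' e : M.graph.edgeSet, ∫⁻ t in Set.Ioo 0 (M.len e), ‖deriv (onEdge f e) t‖ₑ ^ 2

/-- Membership in `H¹`: a continuous square integrable function that lies in `H¹(e)` for every
edge `e` (absolutely continuous with square integrable derivative) and has finite energy. -/
structure MemH1 {M : MetricGraph V} (f : M.Point → ℂ) : Prop where
  continuous : Continuous f
  sqNormL2_lt_top : sqNormL2 f < ∞
  absolutelyContinuous : ∀ e, AbsolutelyContinuousOnInterval (onEdge f e) 0 (M.len e)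
  memLp_deriv : ∀ e, MemLp (deriv (onEdge f e)) 2 (volume.restrict (Set.Ioo 0 (M.len e)))
  energy_lt_top : energy f < ∞

/-- The norm of `H¹`. -/
noncomputable def normH1 {M : MetricGraph V} (f : M.Point → ℂ) : ℝ :=
  √(sqNormL2 f + energy f).toReal

/-! ### The constant -/

/-- The length of a walk (for a path without self-intersections: the total length of its edges). -/
noncomputable def walkLen {u v : V} (p : M.graph.Walk u v) : ℝ :=
  (p.darts.map fun d => M.len ⟨d.edge, d.edge_mem⟩).sum

/-- The diameter: the supremum, in `[0, ∞]`, of the lengths of all (finite) paths without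
self-intersections. -/
noncomputable def diam : ℝ≥0∞ :=
  ⨆ (u : V) (v : V) (p : M.graph.Path u v), ENNReal.ofReal (M.walkLen p.1)

open Classical in
/-- The constant `√(coth (diam / 2))`, where `coth ∞ = 1`. -/
noncomputable def sobolevConst : ℝ :=
  if M.diam = ∞ then 1
  else √(Real.cosh (M.diam.toReal / 2) / Real.sinh (M.diam.toReal / 2))

end MetricGraph

/-! Sobolev bound. If `w' = w² - 1`, then `(w|g|²)' + |g|² + |g'|²` is a square, hence nonnegative.
For `w = tanh(c - ·)` this bounds `tanh(ℓ + T)|g|²` at one end of an interval of length `ℓ` by `tanh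
T |g|²` at the other end plus the squared H¹ norm on the interval. Lengths add inside `tanh`, so the
bound chains along walks (`MemH1.tanh_mul_walk_le`). From every point there starts a trail at least
half as long as any given trail (`exists_trail_half_length`, `MemH1.tanh_mul_edgePt_le`), and a
trail uses no edge twice, so `tanh(L/2)|f(x)|² ≤ ‖f‖²` for every path length `L`; the supremum over
`L` gives the constant.

Values at the ends. Outside a finite edge set `K` the remaining squared norm is at most `η²`. On a
path there of length at most 1, `f` varies by `O(η)`; on a longer path both end values are
themselves `O(η)` by the `tanh` bound. So the oscillation is small whatever the length
(`MemH1.exists_finite_osc_le`). The members of an end sequence eventually avoid `K` by compactness,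
and a connected set avoiding `K` lies over one component of the graph without `K`
(`reachable_anchor`); hence `f` has a limit at each end (`MemH1.exists_endLimit`). These limits give
the continuous extension, unique because every end is a limit of points of the graph.

Rays. The same oscillation bound gives a limit along every ray, equal for equivalent rays. A ray
inside a small `U n` identifies it with the limit at the end. That a corresponding graph end exists
is the combinatorial lemma `exists_ray_eventually_mem`, applied to components in
`EndSeq.exists_ray`. -/

/-! ### Real and imaginary parts of absolutely continuous functions -/

theorem AbsolutelyContinuousOnInterval.of_dist_le {X Y : Type*} [PseudoMetricSpace X]
    [PseudoMetricSpace Y] {f : ℝ → X} {g : ℝ → Y} {a b : ℝ}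
    (hf : AbsolutelyContinuousOnInterval f a b) (h : ∀ x y, dist (g x) (g y) ≤ dist (f x) (f y)) :
    AbsolutelyContinuousOnInterval g a b := by
  unfold AbsolutelyContinuousOnInterval at hf ⊢
  exact squeeze_zero (fun E => Finset.sum_nonneg fun i _ => dist_nonneg)
    (fun E => Finset.sum_le_sum fun i _ => h _ _) hf

theorem AbsolutelyContinuousOnInterval.re {g : ℝ → ℂ} {a b : ℝ}
    (hg : AbsolutelyContinuousOnInterval g a b) :
    AbsolutelyContinuousOnInterval (fun s => (g s).re) a b :=
  hg.of_dist_le fun x y => by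
    rw [Real.dist_eq, dist_eq_norm, ← Complex.sub_re]; exact Complex.abs_re_le_norm _

theorem AbsolutelyContinuousOnInterval.im {g : ℝ → ℂ} {a b : ℝ}
    (hg : AbsolutelyContinuousOnInterval g a b) :
    AbsolutelyContinuousOnInterval (fun s => (g s).im) a b :=
  hg.of_dist_le fun x y => by
    rw [Real.dist_eq, dist_eq_norm, ← Complex.sub_im]; exact Complex.abs_im_le_norm _

/-- Almost everywhere, real and imaginary part are differentiable, with derivatives the real and
imaginary part of the derivative. -/
theorem AbsolutelyContinuousOnInterval.ae_deriv_re_im {g : ℝ → ℂ} {a b : ℝ} (hab : a ≤ b)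
    (hg : AbsolutelyContinuousOnInterval g a b) :
    ∀ᵐ s, s ∈ Set.Ioc a b → deriv (fun s => (g s).re) s = (deriv g s).re ∧
      deriv (fun s => (g s).im) s = (deriv g s).im := by
  filter_upwards [hg.re.ae_differentiableAt, hg.im.ae_differentiableAt] with s h1 h2 hs
  have hs' : s ∈ Set.uIcc a b := by
    rw [Set.uIcc_of_le hab]; exact Set.Ioc_subset_Icc_self hs
  have d1 := (h1 hs').hasDerivAt.ofReal_comp
  have d2 := (h2 hs').hasDerivAt.ofReal_comp
  have d := d1.add (d2.mul_const Complex.I)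
  have e : (fun y => (((g y).re : ℝ) : ℂ)) + (fun y => (((g y).im : ℝ) : ℂ) * Complex.I) = g := by
    funext y; simp [Complex.re_add_im]
  rw [e] at d
  rw [d.deriv]
  simp

/-! ### Trace and oscillation estimates on an interval -/

section Real

variable {g : ℝ → ℝ} {a b : ℝ}

/-- Almost everywhere `(w g²)' + g² + g'² = (w g + g')² ≥ 0`; integrate. -/
theorem AbsolutelyContinuousOnInterval.weight_bound_real {w : ℝ → ℝ} (hab : a ≤ b)
    (hg : AbsolutelyContinuousOnInterval g a b)
    (hg' : IntervalIntegrable (fun s => deriv g s ^ 2) volume a b)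
    (hw : ∀ s, HasDerivAt w (w s ^ 2 - 1) s) :
    w a * g a ^ 2 - w b * g b ^ 2 ≤ ∫ s in a..b, (g s ^ 2 + deriv g s ^ 2) := by
  have hwc : ContDiff ℝ 1 w := by
    rw [contDiff_one_iff_deriv]
    refine ⟨fun s => (hw s).differentiableAt, ?_⟩
    have hc : Continuous w := continuous_iff_continuousAt.2 fun s => (hw s).continuousAt
    rw [show deriv w = fun s => w s ^ 2 - 1 from funext fun s => (hw s).deriv]
    fun_prop
  have hwac : AbsolutelyContinuousOnInterval w a b := hwc.contDiffOn.absolutelyContinuousOnInterval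
  have hφ := hwac.mul (hg.mul hg)
  have key := hφ.integral_deriv_eq_sub
  have hgc : ContinuousOn g (Set.uIcc a b) := hg.continuousOn
  have hint : IntervalIntegrable (fun s => g s ^ 2 + deriv g s ^ 2) volume a b :=
    (hgc.pow 2).intervalIntegrable.add hg'
  have hle : ∫ s in a..b, -(g s ^ 2 + deriv g s ^ 2) ≤ ∫ s in a..b, deriv (w * (g * g)) s := by
    refine intervalIntegral.integral_mono_ae_restrict hab hint.neg hφ.intervalIntegrable_deriv ?_
    rw [Filter.EventuallyLE, ae_restrict_iff' measurableSet_Icc]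
    filter_upwards [hg.ae_differentiableAt] with s hs hs'
    rw [Set.uIcc_of_le hab] at hs
    have d := (hs hs').hasDerivAt
    rw [((hw s).mul (d.mul d)).deriv]
    simp only [Pi.mul_apply]
    nlinarith [sq_nonneg (w s * g s + deriv g s)]
  rw [key, intervalIntegral.integral_neg] at hle
  simp only [Pi.mul_apply] at hle
  nlinarith

/-- Integrate `|g'| ≤ δ + g'²/δ`. The free `δ` replaces Cauchy–Schwarz: the bound is additive in
length and in energy, so it can be summed along walks. -/
theorem AbsolutelyContinuousOnInterval.abs_sub_le_real {δ : ℝ} (hδ : 0 < δ) (hab : a ≤ b)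
    (hg : AbsolutelyContinuousOnInterval g a b)
    (hg' : IntervalIntegrable (fun s => deriv g s ^ 2) volume a b) :
    |g b - g a| ≤ δ * (b - a) + (∫ s in a..b, (g s ^ 2 + deriv g s ^ 2)) / δ := by
  have hgc : ContinuousOn g (Set.uIcc a b) := hg.continuousOn
  have hint : IntervalIntegrable (fun s => g s ^ 2 + deriv g s ^ 2) volume a b :=
    (hgc.pow 2).intervalIntegrable.add hg'
  have hint' : IntervalIntegrable (fun s => δ + (g s ^ 2 + deriv g s ^ 2) / δ) volume a b :=
    intervalIntegrable_const.add (hint.div_const δ)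
  rw [← hg.integral_deriv_eq_sub]
  refine (intervalIntegral.abs_integral_le_integral_abs hab).trans ?_
  refine (intervalIntegral.integral_mono hab hg.intervalIntegrable_deriv.abs hint' ?_).trans_eq ?_
  · intro s
    have h : |deriv g s| * δ ≤ δ * δ + (g s ^ 2 + deriv g s ^ 2) := by
      nlinarith [sq_nonneg (|deriv g s| - δ), sq_abs (deriv g s), sq_nonneg (g s),
        sq_nonneg (|deriv g s|), sq_nonneg δ]
    have h2 : δ + (g s ^ 2 + deriv g s ^ 2) / δ = (δ * δ + (g s ^ 2 + deriv g s ^ 2)) / δ := by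
      field_simp
    change |deriv g s| ≤ δ + (g s ^ 2 + deriv g s ^ 2) / δ
    rw [h2, le_div_iff₀ hδ]
    exact h
  · rw [intervalIntegral.integral_add intervalIntegrable_const (hint.div_const δ),
      intervalIntegral.integral_const, intervalIntegral.integral_div, smul_eq_mul]
    ring

end Real

section Complex

variable {g : ℝ → ℂ} {a b : ℝ}

theorem AbsolutelyContinuousOnInterval.intervalIntegrable_sq_deriv_re_im (hab : a ≤ b)
    (hg : AbsolutelyContinuousOnInterval g a b)
    (hg' : IntervalIntegrable (fun s => ‖deriv g s‖ ^ 2) volume a b) :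
    IntervalIntegrable (fun s => deriv (fun s => (g s).re) s ^ 2) volume a b ∧
      IntervalIntegrable (fun s => deriv (fun s => (g s).im) s ^ 2) volume a b := by
  have h := hg.ae_deriv_re_im hab
  refine ⟨hg'.mono_fun ((measurable_deriv _).pow_const 2).aestronglyMeasurable ?_,
    hg'.mono_fun ((measurable_deriv _).pow_const 2).aestronglyMeasurable ?_⟩
  · rw [Filter.EventuallyLE, ae_restrict_iff' measurableSet_uIoc, Set.uIoc_of_le hab]
    filter_upwards [h] with s hs hs'
    rw [(hs hs').1, Real.norm_of_nonneg (sq_nonneg _), Real.norm_of_nonneg (sq_nonneg _),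
      ← Complex.normSq_eq_norm_sq, Complex.normSq_apply]
    nlinarith [mul_self_nonneg (deriv g s).im]
  · rw [Filter.EventuallyLE, ae_restrict_iff' measurableSet_uIoc, Set.uIoc_of_le hab]
    filter_upwards [h] with s hs hs'
    rw [(hs hs').2, Real.norm_of_nonneg (sq_nonneg _), Real.norm_of_nonneg (sq_nonneg _),
      ← Complex.normSq_eq_norm_sq, Complex.normSq_apply]
    nlinarith [mul_self_nonneg (deriv g s).re]

theorem AbsolutelyContinuousOnInterval.integral_re_add_integral_im (hab : a ≤ b)
    (hg : AbsolutelyContinuousOnInterval g a b)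
    (hg' : IntervalIntegrable (fun s => ‖deriv g s‖ ^ 2) volume a b) :
    (∫ s in a..b, ((g s).re ^ 2 + deriv (fun s => (g s).re) s ^ 2)) +
      (∫ s in a..b, ((g s).im ^ 2 + deriv (fun s => (g s).im) s ^ 2)) =
      ∫ s in a..b, (‖g s‖ ^ 2 + ‖deriv g s‖ ^ 2) := by
  obtain ⟨h1, h2⟩ := hg.intervalIntegrable_sq_deriv_re_im hab hg'
  have i1 : IntervalIntegrable
      (fun s => (g s).re ^ 2 + deriv (fun s => (g s).re) s ^ 2) volume a b :=
    (hg.re.continuousOn.pow 2).intervalIntegrable.add h1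
  have i2 : IntervalIntegrable
      (fun s => (g s).im ^ 2 + deriv (fun s => (g s).im) s ^ 2) volume a b :=
    (hg.im.continuousOn.pow 2).intervalIntegrable.add h2
  rw [← intervalIntegral.integral_add i1 i2]
  refine intervalIntegral.integral_congr_ae ?_
  rw [Set.uIoc_of_le hab]
  filter_upwards [hg.ae_deriv_re_im hab] with s hs hs'
  rw [(hs hs').1, (hs hs').2, ← Complex.normSq_eq_norm_sq, ← Complex.normSq_eq_norm_sq,
    Complex.normSq_apply, Complex.normSq_apply]
  ring

/-- A solution of the Riccati equation `w' = w² - 1` gives a weighted trace inequality. -/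
theorem AbsolutelyContinuousOnInterval.weight_bound {w : ℝ → ℝ} (hab : a ≤ b)
    (hg : AbsolutelyContinuousOnInterval g a b)
    (hg' : IntervalIntegrable (fun s => ‖deriv g s‖ ^ 2) volume a b)
    (hw : ∀ s, HasDerivAt w (w s ^ 2 - 1) s) :
    w a * ‖g a‖ ^ 2 - w b * ‖g b‖ ^ 2 ≤ ∫ s in a..b, (‖g s‖ ^ 2 + ‖deriv g s‖ ^ 2) := by
  obtain ⟨h1, h2⟩ := hg.intervalIntegrable_sq_deriv_re_im hab hg'
  have k1 := hg.re.weight_bound_real hab h1 hw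
  have k2 := hg.im.weight_bound_real hab h2 hw
  rw [← hg.integral_re_add_integral_im hab hg', ← Complex.normSq_eq_norm_sq,
    ← Complex.normSq_eq_norm_sq, Complex.normSq_apply, Complex.normSq_apply]
  linarith

/-- The factor 2 comes from estimating real and imaginary part separately. -/
theorem AbsolutelyContinuousOnInterval.norm_sub_le {δ : ℝ} (hδ : 0 < δ) (hab : a ≤ b)
    (hg : AbsolutelyContinuousOnInterval g a b)
    (hg' : IntervalIntegrable (fun s => ‖deriv g s‖ ^ 2) volume a b) :
    ‖g b - g a‖ ≤ 2 * δ * (b - a) + (∫ s in a..b, (‖g s‖ ^ 2 + ‖deriv g s‖ ^ 2)) / δ := by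
  obtain ⟨h1, h2⟩ := hg.intervalIntegrable_sq_deriv_re_im hab hg'
  have k1 := hg.re.abs_sub_le_real hδ hab h1
  have k2 := hg.im.abs_sub_le_real hδ hab h2
  rw [← hg.integral_re_add_integral_im hab hg', add_div]
  refine (Complex.norm_le_abs_re_add_abs_im _).trans ?_
  rw [Complex.sub_re, Complex.sub_im]
  linarith

theorem Real.hasDerivAt_tanh_sub (c s : ℝ) :
    HasDerivAt (fun s => Real.tanh (c - s)) (Real.tanh (c - s) ^ 2 - 1) s := by
  have h : HasDerivAt (fun s => Real.sinh (c - s) / Real.cosh (c - s)) _ s :=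
    (((hasDerivAt_id s).const_sub c).sinh).div (((hasDerivAt_id s).const_sub c).cosh)
      (Real.cosh_pos _).ne'
  simp only [← Real.tanh_eq_sinh_div_cosh] at h
  convert h using 1
  have := (Real.cosh_pos (c - s)).ne'
  simp only [id, Real.tanh_eq_sinh_div_cosh]
  field_simp
  ring

/-- In applications `T` is the length of the walk that continues beyond `b`; `T = 0` removes the
boundary term. -/
theorem AbsolutelyContinuousOnInterval.tanh_bound_left (hab : a ≤ b) (T : ℝ)
    (hg : AbsolutelyContinuousOnInterval g a b)
    (hg' : IntervalIntegrable (fun s => ‖deriv g s‖ ^ 2) volume a b) :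
    Real.tanh (b - a + T) * ‖g a‖ ^ 2 ≤
      Real.tanh T * ‖g b‖ ^ 2 + ∫ s in a..b, (‖g s‖ ^ 2 + ‖deriv g s‖ ^ 2) := by
  have h := hg.weight_bound hab hg' (Real.hasDerivAt_tanh_sub (b + T))
  rw [show b + T - a = b - a + T by ring, show b + T - b = T by ring] at h
  linarith

theorem AbsolutelyContinuousOnInterval.tanh_bound_right (hab : a ≤ b) (T : ℝ)
    (hg : AbsolutelyContinuousOnInterval g a b)
    (hg' : IntervalIntegrable (fun s => ‖deriv g s‖ ^ 2) volume a b) :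
    Real.tanh (b - a + T) * ‖g b‖ ^ 2 ≤
      Real.tanh T * ‖g a‖ ^ 2 + ∫ s in a..b, (‖g s‖ ^ 2 + ‖deriv g s‖ ^ 2) := by
  have h := hg.weight_bound hab hg' (Real.hasDerivAt_tanh_sub (a - T))
  rw [show a - T - a = -T by ring, show a - T - b = -(b - a + T) by ring, Real.tanh_neg,
    Real.tanh_neg] at h
  linarith

end Complex

/-! ### Trails, edge deletion and construction of rays -/

namespace SimpleGraph

variable {V : Type*} {G : SimpleGraph V}

/-- A walk into a set contains a path that meets the set in its last vertex only. -/
theorem Walk.exists_hitting_path {a u : V} (r : G.Walk a u) (S : Set V) (hu : u ∈ S) :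
    ∃ c ∈ S, ∃ q : G.Walk a c, q.IsPath ∧ ∀ x ∈ q.support, x ∈ S → x = c := by
  classical
  suffices h : ∃ c ∈ S, ∃ q : G.Walk a c, ∀ x ∈ q.support, x ∈ S → x = c by
    obtain ⟨c, hc, q, hq⟩ := h
    exact ⟨c, hc, q.bypass, q.bypass_isPath,
      fun x hx => hq x (q.support_bypass_subset_support hx)⟩
  induction r with
  | nil => exact ⟨_, hu, Walk.nil, fun x hx _ => by simpa using hx⟩
  | @cons a b d h r ih =>
    by_cases ha : a ∈ S
    · exact ⟨a, ha, Walk.nil, fun x hx _ => by simpa using hx⟩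
    · obtain ⟨c, hc, q, hq⟩ := ih hu
      refine ⟨c, hc, Walk.cons h q, fun x hx hxS => ?_⟩
      rw [Walk.support_cons, List.mem_cons] at hx
      rcases hx with rfl | hx
      · exact absurd hxS ha
      · exact hq x hx hxS

theorem Walk.disjoint_edges_of_inter_support {a c u v : V} {q : G.Walk a c} {p : G.Walk u v}
    (h : ∀ x ∈ q.support, x ∈ p.support → x = c) : q.edges.Disjoint p.edges := by
  intro e he he'
  induction e with
  | _ x y =>
    have hx := h x (q.fst_mem_support_of_mem_edges he) (p.fst_mem_support_of_mem_edges he')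
    have hy := h y (q.snd_mem_support_of_mem_edges he) (p.snd_mem_support_of_mem_edges he')
    have := q.adj_of_mem_edges he
    rw [hx, hy] at this
    exact G.loopless.irrefl _ this

/-- From every vertex that is connected to a trail, there starts a trail at least half as long. -/
theorem exists_trail_half_length (ℓ : Sym2 V → ℝ) (hℓ : ∀ e, 0 ≤ ℓ e) {a u v : V}
    (ha : G.Reachable a u) (p : G.Walk u v) (hp : p.IsTrail) :
    ∃ w, ∃ q : G.Walk a w, q.IsTrail ∧ (p.edges.map ℓ).sum ≤ 2 * (q.edges.map ℓ).sum := by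
  classical
  obtain ⟨r⟩ := ha
  -- `q` meets `p` only at `c`, so it can be continued along either part of `p` without repeating an
  -- edge; the longer part is taken.
  obtain ⟨c, hc, q, hq, hqp⟩ := r.exists_hitting_path {x | x ∈ p.support} p.start_mem_support
  have hc' : c ∈ p.support := hc
  have hdis : q.edges.Disjoint p.edges := Walk.disjoint_edges_of_inter_support hqp
  have hsplit : p.edges = (p.takeUntil c hc').edges ++ (p.dropUntil c hc').edges := by
    rw [← Walk.edges_append, Walk.take_spec]
  have hq0 : 0 ≤ (q.edges.map ℓ).sum :=
    List.sum_nonneg fun x hx => by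
      obtain ⟨e, -, rfl⟩ := List.mem_map.1 hx
      exact hℓ e
  have hsum : (p.edges.map ℓ).sum =
      ((p.takeUntil c hc').edges.map ℓ).sum + ((p.dropUntil c hc').edges.map ℓ).sum := by
    rw [hsplit, List.map_append, List.sum_append]
  rcases le_total ((p.takeUntil c hc').edges.map ℓ).sum ((p.dropUntil c hc').edges.map ℓ).sum
    with h | h
  · refine ⟨v, q.append (p.dropUntil c hc'), ?_, ?_⟩
    · rw [Walk.isTrail_append]
      refine ⟨hq.isTrail, hp.dropUntil hc', fun e he he' => hdis he ?_⟩
      rw [hsplit]; exact List.mem_append_right _ he'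
    · rw [Walk.edges_append, List.map_append, List.sum_append]
      linarith
  · refine ⟨u, q.append (p.takeUntil c hc').reverse, ?_, ?_⟩
    · rw [Walk.isTrail_append]
      refine ⟨hq.isTrail, (hp.takeUntil hc').reverse, fun e he he' => hdis he ?_⟩
      rw [hsplit]
      rw [Walk.edges_reverse, List.mem_reverse] at he'
      exact List.mem_append_left _ he'
    · rw [Walk.edges_append, List.map_append, List.sum_append, Walk.edges_reverse,
        List.map_reverse, List.sum_reverse]
      linarith

/-- After deleting an edge, one of its end points remains connected to a given vertex. -/
theorem reachable_deleteEdges_left_or_right {a b u : V} (h : G.Reachable a u) :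
    (G.deleteEdges {s(a, b)}).Reachable a u ∨ (G.deleteEdges {s(a, b)}).Reachable b u := by
  -- After its last passage through the edge, the walk starts at `a` or `b` and survives the
  -- deletion.
  have key : ∀ w, G.Walk w u → (G.deleteEdges {s(a, b)}).Reachable w u ∨
      (G.deleteEdges {s(a, b)}).Reachable a u ∨ (G.deleteEdges {s(a, b)}).Reachable b u := by
    intro w p
    induction p with
    | nil => exact Or.inl (Reachable.refl _)
    | @cons x y z hxy p ih =>
      rcases ih h with ih | ih
      · by_cases hs : s(x, y) = s(a, b)
        · rw [Sym2.eq_iff] at hs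
          rcases hs with ⟨rfl, rfl⟩ | ⟨rfl, rfl⟩
          · exact Or.inr (Or.inr ih)
          · exact Or.inr (Or.inl ih)
        · have : (G.deleteEdges {s(a, b)}).Adj x y := by
            rw [deleteEdges_adj]; exact ⟨hxy, hs⟩
          exact Or.inl (this.reachable.trans ih)
      · exact Or.inr ih
  obtain ⟨p⟩ := h
  rcases key a p with h | h
  · exact Or.inl h
  · exact h

/-- A ray that is eventually contained in every member of a decreasing sequence of vertex sets with
empty intersection, provided that every member is linked inside itself to the next one. -/
theorem exists_ray_eventually_mem (C : ℕ → Set V) (hanti : Antitone C) (hne : (C 0).Nonempty)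
    (hinter : ∀ v, ∃ n, v ∉ C n)
    (hstep : ∀ n, ∀ v ∈ C n, ∃ w ∈ C (n + 1), ∃ p : G.Walk v w, ∀ x ∈ p.support, x ∈ C n) :
    ∃ R : GraphRay G, ∀ n, ∃ N, ∀ i ≥ N, R.vert i ∈ C n := by
  classical
  -- `D` is the depth: since `C` is antitone, `C n = {D > n}`.
  let D : V → ℕ := fun v => Nat.find (hinter v)
  have hD : ∀ v n, v ∈ C n ↔ n < D v := by
    intro v n
    rw [Nat.lt_find_iff]
    exact ⟨fun h m hm => not_not.2 (hanti hm h), fun h => not_not.1 (h n le_rfl)⟩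
  -- Lengths of walks from `v` to a strictly deeper vertex that never get shallower than `v`; `d v`
  -- is the least one.
  let P : V → Set ℕ := fun v => {k | ∃ w ∈ C (D v), ∃ p : G.Walk v w,
    p.length = k ∧ ∀ x ∈ p.support, D v ≤ D x}
  have hP : ∀ v ∈ C 0, (P v).Nonempty := by
    intro v hv
    have h0 : 0 < D v := (hD v 0).1 hv
    obtain ⟨n, hn⟩ : ∃ n, D v = n + 1 := ⟨D v - 1, by omega⟩
    obtain ⟨w, hw, p, hp⟩ := hstep n v ((hD v n).2 (by omega))
    refine ⟨p.length, w, by rwa [hn], p, rfl, fun x hx => ?_⟩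
    have := (hD x n).1 (hp x hx)
    omega
  let d : V → ℕ := fun v => sInf (P v)
  -- Lexicographic progress: the first step of a shortest such walk gains depth, or keeps it and
  -- lowers `d`. Transitivity of `Q` will make the iterates distinct.
  let Q : V → V → Prop := fun v v' => D v < D v' ∨ (D v = D v' ∧ d v' < d v)
  have hnext : ∀ v : {v // v ∈ C 0}, ∃ v' : {v // v ∈ C 0}, G.Adj v v' ∧ Q v v' := by
    rintro ⟨v, hv⟩
    obtain ⟨w, hw, p, hpl, hp⟩ := Nat.sInf_mem (hP v hv)
    cases p with
    | nil => exact absurd ((hD v _).1 hw) (lt_irrefl _)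
    | @cons _ v' _ h p =>
      have hv' : D v ≤ D v' := hp v' (by simp)
      refine ⟨⟨v', (hD v' 0).2 (((hD v 0).1 hv).trans_le hv')⟩, h, ?_⟩
      rcases hv'.lt_or_eq with hlt | heq
      · exact Or.inl hlt
      · refine Or.inr ⟨heq, ?_⟩
        have : d v' ≤ p.length :=
          Nat.sInf_le ⟨w, by rwa [← heq], p, rfl, fun x hx => by
            rw [← heq]; exact hp x (by simp [hx])⟩
        rw [Walk.length_cons] at hpl
        change d v' < sInf (P v)
        omega
  choose next hadj hQ using hnext
  obtain ⟨v₀, hv₀⟩ := hne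
  let r : ℕ → {v // v ∈ C 0} := fun i => next^[i] ⟨v₀, hv₀⟩
  have hr : ∀ i, r (i + 1) = next (r i) := fun i => Function.iterate_succ_apply' _ _ _
  have hQr : ∀ i, Q (r i) (r (i + 1)) := fun i => by rw [hr]; exact hQ _
  have hQlt : ∀ i j, i < j → Q (r i) (r j) := by
    intro i j hij
    induction hij with
    | refl => exact hQr i
    | @step m _ ih =>
      have := hQr m
      simp only [Q, Nat.succ_eq_add_one] at ih this ⊢
      omega
  have hmono : Monotone fun i => D (r i) := monotone_nat_of_le_succ fun i => by
    have := hQr i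
    simp only [Q] at this
    omega
  have hunb : ∀ n, ∃ N, n < D (r N) := by
    intro n
    induction n with
    | zero => exact ⟨0, (hD _ 0).1 (r 0).2⟩
    | succ n ih =>
      obtain ⟨N, hN⟩ := ih
      -- If the depth stayed at `n + 1`, then `d` would drop at every step forever.
      by_contra! hcon
      have hk : ∀ k, d (r (N + k)) + k ≤ d (r N) := by
        intro k
        induction k with
        | zero => simp
        | succ k ihk =>
          have h1 := hQr (N + k)
          have h2 := hcon (N + k + 1)
          have h3 : D (r N) ≤ D (r (N + k)) := hmono (Nat.le_add_right _ _)
          simp only [Q] at h1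
          change d (r (N + k + 1)) + (k + 1) ≤ d (r N)
          omega
      have := hk (d (r N) + 1)
      omega
  refine ⟨⟨fun i => r i, ?_, fun n => ?_⟩, fun n => ?_⟩
  · intro i j heq
    have heq' : (r i : V) = r j := heq
    rcases lt_trichotomy i j with hij | hij | hij
    · have := hQlt i j hij
      simp only [Q, heq'] at this
      omega
    · exact hij
    · have := hQlt j i hij
      simp only [Q, heq'] at this
      omega
  · rw [hr]; exact hadj _
  · obtain ⟨N, hN⟩ := hunb n
    exact ⟨N, fun i hi => (hD _ n).2 (hN.trans_le (hmono hi))⟩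

end SimpleGraph

/-! ### Tails and edges of rays -/

namespace GraphRay

variable {V : Type*} {G : SimpleGraph V}

/-- The tail of a ray. -/
def tail (R : GraphRay G) (N : ℕ) : GraphRay G where
  vert n := R.vert (N + n)
  injective := R.injective.comp (add_right_injective N)
  adj n := R.adj (N + n)

theorem equivalent_tail (R : GraphRay G) (N : ℕ) : (R.tail N).Equivalent R := by
  have h : Set.range (R.tail N).vert ⊆ Set.range R.vert := by
    rintro _ ⟨n, rfl⟩
    exact ⟨N + n, rfl⟩
  have hinf : (Set.range (R.tail N).vert).Infinite :=
    Set.infinite_range_of_injective (R.tail N).injective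
  refine ⟨R.tail N, by rwa [Set.inter_self], by rwa [Set.inter_eq_left.2 h]⟩

theorem edge_injective (R : GraphRay G) : Function.Injective R.edge := by
  intro m n h
  have h' : s(R.vert m, R.vert (m + 1)) = s(R.vert n, R.vert (n + 1)) := congrArg Subtype.val h
  rw [Sym2.eq_iff] at h'
  rcases h' with ⟨h1, -⟩ | ⟨h1, h2⟩
  · exact R.injective h1
  · have h1 := R.injective h1
    have h2 := R.injective h2
    omega

/-- All but finitely many edges of a ray avoid a given finite set of edges. -/
theorem exists_forall_edge_notMem (R : GraphRay G) {K : Set G.edgeSet} (hK : K.Finite) :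
    ∃ N, ∀ n ≥ N, R.edge n ∉ K := by
  have h : (R.edge ⁻¹' K).Finite := hK.preimage R.edge_injective.injOn
  obtain ⟨N, hN⟩ := h.bddAbove
  exact ⟨N + 1, fun n hn hmem => by have := hN hmem; omega⟩

end GraphRay

/-! ### Topology of the metric graph -/

/-- Off the frontier, the space is the disjoint union of the open sets `U` and `(closure U)ᶜ`. -/
theorem IsPreconnected.subset_of_disjoint_frontier {X : Type*} [TopologicalSpace X] {S U : Set X}
    (hS : IsPreconnected S) (hU : IsOpen U) (hfr : Disjoint S (frontier U))
    (hne : (S ∩ U).Nonempty) : S ⊆ U := by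
  refine hS.subset_left_of_subset_union hU isClosed_closure.isOpen_compl
    (disjoint_compl_right.mono_left subset_closure) ?_ hne
  intro x hx
  by_cases hxU : x ∈ U
  · exact Or.inl hxU
  · refine Or.inr fun hc => Set.disjoint_left.1 hfr hx ?_
    rw [hU.frontier_eq]
    exact ⟨hc, hxU⟩

namespace MetricGraph

variable {V : Type*} {M : MetricGraph V}

theorem adj_src_tgt (e : M.graph.edgeSet) : M.graph.Adj (M.src e) (M.tgt e) := by
  have h := e.2
  rwa [← M.ends e, SimpleGraph.mem_edgeSet] at h

theorem edgePt_of_nonpos {e : M.graph.edgeSet} {t : ℝ} (h : t ≤ 0) :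
    M.edgePt e t = .vertex (M.src e) := by
  simp [edgePt, h]

theorem edgePt_of_len_le {e : M.graph.edgeSet} {t : ℝ} (h : M.len e ≤ t) :
    M.edgePt e t = .vertex (M.tgt e) := by
  have : ¬ t ≤ 0 := not_le.2 ((M.len_pos e).trans_le h)
  simp [edgePt, h, this]

theorem edgePt_of_mem_Ioo {e : M.graph.edgeSet} {t : ℝ} (h : t ∈ Set.Ioo 0 (M.len e)) :
    M.edgePt e t = .inner e ⟨t, h⟩ := by
  simp [edgePt, not_le.2 h.1, not_le.2 h.2]

/-- The closed edge `e` as a subset of the metric graph. -/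
def closedEdge (M : MetricGraph V) (e : M.graph.edgeSet) : Set M.Point :=
  M.edgePt e '' Set.Icc 0 (M.len e)

theorem edgePt_mem_closedEdge (e : M.graph.edgeSet) (t : ℝ) : M.edgePt e t ∈ M.closedEdge e := by
  have h0 := (M.len_pos e).le
  rcases le_total t 0 with h | h
  · exact ⟨0, ⟨le_rfl, h0⟩, by rw [edgePt_of_nonpos h, edgePt_of_nonpos le_rfl]⟩
  rcases le_total (M.len e) t with h' | h'
  · exact ⟨M.len e, ⟨h0, le_rfl⟩, by rw [edgePt_of_len_le h', edgePt_of_len_le le_rfl]⟩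
  · exact ⟨t, ⟨h, h'⟩, rfl⟩

theorem inner_mem_closedEdge_iff {e e' : M.graph.edgeSet} {t : Set.Ioo (0 : ℝ) (M.len e')} :
    .inner e' t ∈ M.closedEdge e ↔ e' = e := by
  constructor
  · rintro ⟨s, hs, hst⟩
    by_cases h0 : s ≤ 0
    · rw [edgePt_of_nonpos h0] at hst; cases hst
    by_cases h1 : M.len e ≤ s
    · rw [edgePt_of_len_le h1] at hst; cases hst
    rw [edgePt_of_mem_Ioo ⟨not_le.1 h0, not_le.1 h1⟩] at hst
    cases hst
    rfl
  · rintro rfl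
    have := edgePt_mem_closedEdge e' t.1
    rwa [edgePt_of_mem_Ioo t.2] at this

theorem vertex_mem_closedEdge_iff {e : M.graph.edgeSet} {v : V} :
    .vertex v ∈ M.closedEdge e ↔ v ∈ e.1 := by
  rw [← M.ends e, Sym2.mem_iff]
  constructor
  · rintro ⟨s, hs, hst⟩
    by_cases h0 : s ≤ 0
    · rw [edgePt_of_nonpos h0] at hst; cases hst; exact Or.inl rfl
    by_cases h1 : M.len e ≤ s
    · rw [edgePt_of_len_le h1] at hst; cases hst; exact Or.inr rfl
    rw [edgePt_of_mem_Ioo ⟨not_le.1 h0, not_le.1 h1⟩] at hst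
    cases hst
  · rintro (rfl | rfl)
    · rw [← edgePt_of_nonpos (e := e) le_rfl]; exact edgePt_mem_closedEdge _ _
    · rw [← edgePt_of_len_le (e := e) le_rfl]; exact edgePt_mem_closedEdge _ _

theorem continuous_edgePt (e : M.graph.edgeSet) : Continuous (M.edgePt e) := by
  have h0 := (M.len_pos e).le
  have h1 : Continuous fun t : Set.Icc (0 : ℝ) (M.len e) => M.edgePt e t := by
    rw [continuous_iff_coinduced_le]
    exact le_iSup (fun e : M.graph.edgeSet => TopologicalSpace.coinduced
      (fun t : Set.Icc (0 : ℝ) (M.len e) => M.edgePt e t) inferInstance) e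
  have h2 : M.edgePt e = (fun t : Set.Icc (0 : ℝ) (M.len e) => M.edgePt e t) ∘
      Set.projIcc 0 (M.len e) h0 := by
    funext t
    rcases le_total t 0 with h | h
    · simp [Set.projIcc_of_le_left _ h, edgePt_of_nonpos h, edgePt_of_nonpos le_rfl]
    rcases le_total (M.len e) t with h' | h'
    · simp [Set.projIcc_of_right_le _ h', edgePt_of_len_le h', edgePt_of_len_le le_rfl]
    · simp [Set.projIcc_of_mem h0 ⟨h, h'⟩]
  rw [h2]
  exact h1.comp continuous_projIcc

theorem isOpen_iff {U : Set M.Point} : IsOpen U ↔ ∀ e, IsOpen (M.edgePt e ⁻¹' U) := by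
  refine ⟨fun h e => h.preimage (continuous_edgePt e), fun h => ?_⟩
  change IsOpen[⨆ _, _] U
  rw [isOpen_iSup_iff]
  intro e
  rw [isOpen_coinduced]
  exact (h e).preimage continuous_subtype_val

theorem isClosed_iff {S : Set M.Point} :
    IsClosed S ↔ ∀ e, IsClosed ((fun t : Set.Icc (0 : ℝ) (M.len e) => M.edgePt e t) ⁻¹' S) := by
  refine ⟨fun h e => h.preimage ((continuous_edgePt e).comp continuous_subtype_val), fun h => ?_⟩
  rw [← isOpen_compl_iff]
  change IsOpen[⨆ _, _] Sᶜ
  rw [isOpen_iSup_iff]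
  intro e
  rw [isOpen_coinduced, Set.preimage_compl, isOpen_compl_iff]
  exact h e

theorem isCompact_closedEdge (e : M.graph.edgeSet) : IsCompact (M.closedEdge e) :=
  isCompact_Icc.image (continuous_edgePt e)

theorem isPreconnected_closedEdge (e : M.graph.edgeSet) : IsPreconnected (M.closedEdge e) :=
  isPreconnected_Icc.image _ (continuous_edgePt e).continuousOn

/-- Every union of closed edges is closed. -/
theorem isClosed_biUnion_closedEdge (K : Set M.graph.edgeSet) :
    IsClosed (⋃ e ∈ K, M.closedEdge e) := by
  rw [isClosed_iff]
  intro e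
  by_cases he : e ∈ K
  · convert isClosed_univ
    rw [Set.eq_univ_iff_forall]
    exact fun t => Set.mem_biUnion he (edgePt_mem_closedEdge e t)
  · refine Set.Finite.isClosed (Set.Finite.subset (Set.toFinite
      {⟨0, le_rfl, (M.len_pos e).le⟩, ⟨M.len e, (M.len_pos e).le, le_rfl⟩}) ?_)
    rintro ⟨t, ht0, ht1⟩ hmem
    rcases ht0.eq_or_lt with h | h
    · subst h; exact Or.inl rfl
    rcases ht1.eq_or_lt with h' | h'
    · subst h'; exact Or.inr rfl
    exfalso
    obtain ⟨e', he', hmem⟩ := Set.mem_iUnion₂.1 hmem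
    change M.edgePt e t ∈ _ at hmem
    rw [edgePt_of_mem_Ioo ⟨h, h'⟩, inner_mem_closedEdge_iff] at hmem
    exact he (hmem ▸ he')

/-- The vertex itself, or the initial vertex of the edge containing the point. -/
def anchor : M.Point → V
  | .vertex v => v
  | .inner e _ => M.src e

/-- A preconnected set that avoids the edges in `K` lies in a single component of the graph
without the edges in `K`. -/
theorem reachable_anchor {U : Set M.Point} (hU : IsPreconnected U) {K : Set M.graph.edgeSet}
    (hK : ∀ e ∈ K, Disjoint U (M.closedEdge e)) {x y : M.Point} (hx : x ∈ U) (hy : y ∈ U) :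
    (M.graph.deleteEdges (Subtype.val '' K)).Reachable (anchor x) (anchor y) := by
  set H := M.graph.deleteEdges (Subtype.val '' K) with hH
  -- A property of vertices invariant under adjacency in `H` is constant along each edge outside
  -- `K`; so the reachable and the unreachable points both form open sets.
  have hopen : ∀ p : V → Prop, (∀ v w, H.Adj v w → (p v ↔ p w)) →
      IsOpen ((⋃ e ∈ K, M.closedEdge e)ᶜ ∩ {z | p (anchor z)}) := by
    intro p hp
    rw [isOpen_iff]
    intro e
    by_cases he : e ∈ K
    · convert isOpen_empty
      rw [Set.eq_empty_iff_forall_notMem]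
      exact fun t ht => ht.1 (Set.mem_biUnion he (edgePt_mem_closedEdge e t))
    · have hadj : H.Adj (M.src e) (M.tgt e) := by
        rw [hH, SimpleGraph.deleteEdges_adj]
        refine ⟨adj_src_tgt e, ?_⟩
        rintro ⟨e', he', h⟩
        rw [M.ends e] at h
        exact he (Subtype.ext h ▸ he')
      have hc : ∀ t, p (anchor (M.edgePt e t)) ↔ p (M.src e) := by
        intro t
        by_cases h0 : t ≤ 0
        · rw [edgePt_of_nonpos h0]; rfl
        by_cases h1 : M.len e ≤ t
        · rw [edgePt_of_len_le h1]; exact (hp _ _ hadj).symm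
        rw [edgePt_of_mem_Ioo ⟨not_le.1 h0, not_le.1 h1⟩]; rfl
      rw [Set.preimage_inter]
      refine ((isClosed_biUnion_closedEdge K).isOpen_compl.preimage (continuous_edgePt e)).inter ?_
      simp only [Set.preimage_ofPred_eq, hc]
      exact isOpen_const
  have hreach : ∀ v w, H.Adj v w → (H.Reachable (anchor x) v ↔ H.Reachable (anchor x) w) :=
    fun v w h => ⟨fun h' => h'.trans h.reachable, fun h' => h'.trans h.symm.reachable⟩
  have hUK : ∀ z ∈ U, z ∈ (⋃ e ∈ K, M.closedEdge e)ᶜ := by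
    intro z hz hz'
    obtain ⟨e, he, hze⟩ := Set.mem_iUnion₂.1 hz'
    exact Set.disjoint_left.1 (hK e he) hz hze
  have hsub := hU.subset_left_of_subset_union (hopen _ hreach)
    (hopen (fun v => ¬ H.Reachable (anchor x) v) fun v w h => not_congr (hreach v w h))
    (Set.disjoint_left.2 fun z hz hz' => hz'.2 hz.2)
    (fun z hz => by
      by_cases h : H.Reachable (anchor x) (anchor z)
      · exact Or.inl ⟨hUK z hz, h⟩
      · exact Or.inr ⟨hUK z hz, h⟩)
    ⟨x, hx, hUK x hx, SimpleGraph.Reachable.refl _⟩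
  exact (hsub hy).2

theorem finite_setOf_mem_edge (hlf : ∀ v, (M.graph.neighborSet v).Finite) (v : V) :
    {e : M.graph.edgeSet | v ∈ e.1}.Finite := by
  refine Set.Finite.subset (((hlf v).image fun w => s(v, w)).preimage
    Subtype.val_injective.injOn) ?_
  rintro ⟨e, he⟩ (hv : v ∈ e)
  obtain ⟨w, rfl⟩ := Sym2.mem_iff_exists.1 hv
  exact ⟨w, he, rfl⟩

/-- A compact set meets only finitely many edges. -/
theorem finite_setOf_closedEdge_inter
    (hlf : ∀ v, (M.graph.neighborSet v).Finite)
    {Q : Set M.Point} (hQ : IsCompact Q) :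
    {e | (M.closedEdge e ∩ Q).Nonempty}.Finite := by
  -- An open set that meets only edges incident to `v`, of which there are finitely many.
  let S : V → Set M.Point := fun v => (⋃ e ∈ {e : M.graph.edgeSet | v ∉ e.1}, M.closedEdge e)ᶜ
  have hcov : Q ⊆ ⋃ v, S v := by
    intro z _
    refine Set.mem_iUnion.2 ⟨anchor z, fun hz => ?_⟩
    obtain ⟨e, he, hze⟩ := Set.mem_iUnion₂.1 hz
    cases z with
    | vertex v => exact he (vertex_mem_closedEdge_iff.1 hze)
    | inner e' t =>
      obtain rfl := inner_mem_closedEdge_iff.1 hze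
      refine he ?_
      rw [← M.ends e']
      exact Sym2.mem_mk_left _ _
  obtain ⟨T, hT⟩ := hQ.elim_finite_subcover S
    (fun v => (isClosed_biUnion_closedEdge _).isOpen_compl) hcov
  refine Set.Finite.subset (T.finite_toSet.biUnion fun v _ => finite_setOf_mem_edge hlf v) ?_
  rintro e ⟨z, hze, hzQ⟩
  obtain ⟨v, hv, hzv⟩ := Set.mem_iUnion₂.1 (hT hzQ)
  refine Set.mem_biUnion hv ?_
  by_contra hve
  exact hzv (Set.mem_biUnion (show e ∈ {e : M.graph.edgeSet | v ∉ e.1} from hve) hze)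

namespace EndSeq

theorem antitone (s : M.EndSeq) : Antitone s.U := antitone_nat_of_succ_le s.decreasing

/-- The closures decrease to the empty set, so by compactness one of them already misses `Q`. -/
theorem exists_forall_disjoint_of_isCompact (s : M.EndSeq) {Q : Set M.Point} (hQ : IsCompact Q) :
    ∃ n, ∀ m ≥ n, Disjoint (s.U m) Q := by
  obtain ⟨n, hn⟩ := hQ.elim_directed_family_closed (fun n => closure (s.U n))
    (fun n => isClosed_closure) (by rw [s.iInter_closure, Set.inter_empty])
    (antitone_nat_of_succ_le fun n => closure_mono (s.decreasing n)).directed_ge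
  refine ⟨n, fun m hm => Set.disjoint_left.2 fun z hz hzQ => ?_⟩
  have : z ∈ Q ∩ closure (s.U n) := ⟨hzQ, subset_closure (s.antitone hm hz)⟩
  rwa [hn] at this

theorem exists_forall_disjoint_closedEdge (s : M.EndSeq) {K : Set M.graph.edgeSet}
    (hK : K.Finite) : ∃ n, ∀ m ≥ n, ∀ e ∈ K, Disjoint (s.U m) (M.closedEdge e) := by
  obtain ⟨n, hn⟩ := s.exists_forall_disjoint_of_isCompact
    (hK.isCompact_biUnion fun e _ => M.isCompact_closedEdge e)
  exact ⟨n, fun m hm e he => (hn m hm).mono_right (Set.subset_biUnion_of_mem he)⟩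

end EndSeq

end MetricGraph

/-! ### Small oscillation from the two bounds -/

theorem Real.tanh_monotone : Monotone Real.tanh := fun x y h => by
  rwa [← Real.artanh_le_artanh_iff ⟨Real.neg_one_lt_tanh x, Real.tanh_lt_one x⟩
    ⟨Real.neg_one_lt_tanh y, Real.tanh_lt_one y⟩, Real.artanh_tanh, Real.artanh_tanh]

theorem Real.quarter_le_tanh_one : 1 / 4 ≤ Real.tanh 1 := by
  have h1 : (1 : ℝ) ≤ Real.sinh 1 := Real.self_le_sinh_iff.2 zero_le_one
  have h2 : Real.cosh 1 ≤ 4 := by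
    have := Real.exp_one_lt_d9
    have h3 : Real.exp (-1) ≤ 1 := Real.exp_le_one_iff.2 (by norm_num)
    rw [Real.cosh_eq]
    linarith
  rw [Real.tanh_eq_sinh_div_cosh, div_le_div_iff₀ (by norm_num) (Real.cosh_pos 1)]
  linarith

/-- Combination of a bound for short and a bound for long intervals. -/
theorem norm_sub_le_of_tanh_bounds {E : Type*} [NormedAddCommGroup E] {a b : E} {T η : ℝ}
    (hη : 0 < η) (h : ∀ δ > 0, ‖b - a‖ ≤ 2 * δ * T + η ^ 2 / δ)
    (ha : Real.tanh T * ‖a‖ ^ 2 ≤ η ^ 2) (hb : Real.tanh T * ‖b‖ ^ 2 ≤ η ^ 2) :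
    ‖b - a‖ ≤ 4 * η := by
  rcases le_total T 1 with hT | hT
  · have h1 := h η hη
    have h2 : η ^ 2 / η = η := by field_simp
    rw [h2] at h1
    nlinarith
  · have hq := Real.quarter_le_tanh_one.trans (Real.tanh_monotone hT)
    have key : ∀ x : E, Real.tanh T * ‖x‖ ^ 2 ≤ η ^ 2 → ‖x‖ ≤ 2 * η := fun x hx =>
      abs_le_of_sq_le_sq' (by nlinarith [sq_nonneg ‖x‖]) (by positivity) |>.2
    have := norm_sub_le b a
    linarith [key a ha, key b hb]

/-! ### Estimates for H¹ functions along edges and walks -/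

namespace MetricGraph

variable {V : Type*} {M : MetricGraph V}

/-- Extension by zero of a function on the edges to all unordered pairs. -/
noncomputable def extendEdges (M : MetricGraph V) (φ : M.graph.edgeSet → ℝ) : Sym2 V → ℝ :=
  Function.extend Subtype.val φ 0

theorem extendEdges_val (φ : M.graph.edgeSet → ℝ) (e : M.graph.edgeSet) :
    M.extendEdges φ e.1 = φ e :=
  Subtype.val_injective.extend_apply _ _ _

theorem extendEdges_nonneg {φ : M.graph.edgeSet → ℝ} (hφ : ∀ e, 0 ≤ φ e) (e : Sym2 V) :
    0 ≤ M.extendEdges φ e := by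
  by_cases h : e ∈ M.graph.edgeSet
  · exact (hφ ⟨e, h⟩).trans_eq (extendEdges_val φ ⟨e, h⟩).symm
  · rw [extendEdges, Function.extend_apply']
    · exact le_rfl
    · rintro ⟨e', rfl⟩; exact h e'.2

theorem walkLen_eq {u v : V} (p : M.graph.Walk u v) :
    M.walkLen p = (p.edges.map (M.extendEdges M.len)).sum := by
  rw [walkLen, SimpleGraph.Walk.edges, List.map_map]
  congr 1
  refine List.map_congr_left fun d _ => ?_
  exact (extendEdges_val M.len ⟨d.edge, d.edge_mem⟩).symm

/-- The squared `H¹` norm of `f` on the edge `e`. -/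
noncomputable def edgeEnergy (f : M.Point → ℂ) (e : M.graph.edgeSet) : ℝ :=
  ∫ s in (0 : ℝ)..M.len e, (‖onEdge f e s‖ ^ 2 + ‖deriv (onEdge f e) s‖ ^ 2)

theorem edgeEnergy_nonneg (f : M.Point → ℂ) (e : M.graph.edgeSet) : 0 ≤ edgeEnergy f e :=
  intervalIntegral.integral_nonneg (M.len_pos e).le fun s _ => by positivity

namespace MemH1

variable {f : M.Point → ℂ} (hf : MemH1 f)
include hf

theorem continuous_onEdge (e : M.graph.edgeSet) : Continuous (onEdge f e) :=
  hf.continuous.comp (continuous_edgePt e)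

theorem intervalIntegrable_sq_deriv (e : M.graph.edgeSet) :
    IntervalIntegrable (fun s => ‖deriv (onEdge f e) s‖ ^ 2) volume 0 (M.len e) := by
  rw [intervalIntegrable_iff_integrableOn_Ioo_of_le (M.len_pos e).le]
  exact (memLp_two_iff_integrable_sq_norm (hf.memLp_deriv e).1).1 (hf.memLp_deriv e)

theorem intervalIntegrable (e : M.graph.edgeSet) :
    IntervalIntegrable (fun s => ‖onEdge f e s‖ ^ 2 + ‖deriv (onEdge f e) s‖ ^ 2) volume 0
      (M.len e) :=
  ((hf.continuous_onEdge e).norm.pow 2).intervalIntegrable _ _ |>.add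
    (hf.intervalIntegrable_sq_deriv e)

theorem ofReal_edgeEnergy (e : M.graph.edgeSet) :
    ENNReal.ofReal (edgeEnergy f e) = (∫⁻ t in Set.Ioo 0 (M.len e), ‖onEdge f e t‖ₑ ^ 2) +
      ∫⁻ t in Set.Ioo 0 (M.len e), ‖deriv (onEdge f e) t‖ₑ ^ 2 := by
  have hint := hf.intervalIntegrable e
  rw [intervalIntegrable_iff_integrableOn_Ioo_of_le (M.len_pos e).le] at hint
  rw [edgeEnergy, intervalIntegral.integral_of_le (M.len_pos e).le,
    integral_Ioc_eq_integral_Ioo,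
    ofReal_integral_eq_lintegral_ofReal hint (ae_of_all _ fun s => by positivity),
    ← lintegral_add_left ((hf.continuous_onEdge e).enorm.measurable.pow_const 2)]
  refine lintegral_congr fun s => ?_
  rw [ENNReal.ofReal_add (by positivity) (by positivity), ENNReal.ofReal_pow (norm_nonneg _),
    ENNReal.ofReal_pow (norm_nonneg _), ofReal_norm, ofReal_norm]

theorem tsum_ofReal_edgeEnergy :
    ∑' e, ENNReal.ofReal (edgeEnergy f e) = sqNormL2 f + energy f := by
  rw [sqNormL2, energy, ← ENNReal.tsum_add]
  exact tsum_congr fun e => hf.ofReal_edgeEnergy e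

theorem tsum_ofReal_edgeEnergy_ne_top : ∑' e, ENNReal.ofReal (edgeEnergy f e) ≠ ∞ := by
  rw [hf.tsum_ofReal_edgeEnergy]
  exact ENNReal.add_ne_top.2 ⟨hf.sqNormL2_lt_top.ne, hf.energy_lt_top.ne⟩

theorem summable_edgeEnergy : Summable (edgeEnergy f) := by
  have h := ENNReal.summable_toReal hf.tsum_ofReal_edgeEnergy_ne_top
  simpa only [ENNReal.toReal_ofReal (edgeEnergy_nonneg f _)] using h

theorem normH1_sq : normH1 f ^ 2 = ∑' e, edgeEnergy f e := by
  rw [normH1, Real.sq_sqrt ENNReal.toReal_nonneg, ← hf.tsum_ofReal_edgeEnergy,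
    ENNReal.tsum_toReal_eq fun _ => ENNReal.ofReal_ne_top]
  exact tsum_congr fun e => ENNReal.toReal_ofReal (edgeEnergy_nonneg f e)

/-- Summing over all of `Sym2 V` lets edge lists of walks in any subgraph be compared with one and
the same series. -/
theorem hasSum_extendEdges : HasSum (M.extendEdges (edgeEnergy f)) (normH1 f ^ 2) := by
  rw [extendEdges, hasSum_extend_zero Subtype.val_injective, hf.normH1_sq]
  exact hf.summable_edgeEnergy.hasSum

theorem tanh_mul_left_le (e : M.graph.edgeSet) {t : ℝ} (ht : t ∈ Set.Icc 0 (M.len e)) (T : ℝ) :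
    Real.tanh (t + T) * ‖f (M.edgePt e t)‖ ^ 2 ≤
      Real.tanh T * ‖f (.vertex (M.src e))‖ ^ 2 + edgeEnergy f e := by
  have hsub : Set.uIcc 0 t ⊆ Set.uIcc 0 (M.len e) :=
    Set.uIcc_subset_uIcc_left (by rw [Set.uIcc_of_le (ht.1.trans ht.2)]; exact ht)
  have h := ((hf.absolutelyContinuous e).mono hsub).tanh_bound_right ht.1 T
    ((hf.intervalIntegrable_sq_deriv e).mono_set hsub)
  have hE : (∫ s in (0 : ℝ)..t, (‖onEdge f e s‖ ^ 2 + ‖deriv (onEdge f e) s‖ ^ 2)) ≤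
      edgeEnergy f e :=
    intervalIntegral.integral_mono_interval le_rfl ht.1 ht.2
      (ae_of_all _ fun s => by positivity) (hf.intervalIntegrable e)
  simp only [onEdge, edgePt_of_nonpos le_rfl, sub_zero] at h hE ⊢
  linarith

theorem tanh_mul_right_le (e : M.graph.edgeSet) {t : ℝ} (ht : t ∈ Set.Icc 0 (M.len e)) (T : ℝ) :
    Real.tanh (M.len e - t + T) * ‖f (M.edgePt e t)‖ ^ 2 ≤
      Real.tanh T * ‖f (.vertex (M.tgt e))‖ ^ 2 + edgeEnergy f e := by
  have hsub : Set.uIcc t (M.len e) ⊆ Set.uIcc 0 (M.len e) :=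
    Set.uIcc_subset_uIcc_right (by rw [Set.uIcc_of_le (ht.1.trans ht.2)]; exact ht)
  have h := ((hf.absolutelyContinuous e).mono hsub).tanh_bound_left ht.2 T
    ((hf.intervalIntegrable_sq_deriv e).mono_set hsub)
  have hE : (∫ s in t..M.len e, (‖onEdge f e s‖ ^ 2 + ‖deriv (onEdge f e) s‖ ^ 2)) ≤
      edgeEnergy f e :=
    intervalIntegral.integral_mono_interval ht.1 ht.2 le_rfl
      (ae_of_all _ fun s => by positivity) (hf.intervalIntegrable e)
  simp only [onEdge, edgePt_of_len_le le_rfl] at h hE ⊢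
  linarith

theorem norm_sub_src_le (e : M.graph.edgeSet) {t : ℝ} (ht : t ∈ Set.Icc 0 (M.len e)) {δ : ℝ}
    (hδ : 0 < δ) :
    ‖f (M.edgePt e t) - f (.vertex (M.src e))‖ ≤ 2 * δ * t + edgeEnergy f e / δ := by
  have hsub : Set.uIcc 0 t ⊆ Set.uIcc 0 (M.len e) :=
    Set.uIcc_subset_uIcc_left (by rw [Set.uIcc_of_le (ht.1.trans ht.2)]; exact ht)
  have h := ((hf.absolutelyContinuous e).mono hsub).norm_sub_le hδ ht.1
    ((hf.intervalIntegrable_sq_deriv e).mono_set hsub)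
  have hE : (∫ s in (0 : ℝ)..t, (‖onEdge f e s‖ ^ 2 + ‖deriv (onEdge f e) s‖ ^ 2)) ≤
      edgeEnergy f e :=
    intervalIntegral.integral_mono_interval le_rfl ht.1 ht.2
      (ae_of_all _ fun s => by positivity) (hf.intervalIntegrable e)
  have hE' := div_le_div_of_nonneg_right hE hδ.le
  simp only [onEdge, edgePt_of_nonpos le_rfl, sub_zero] at h hE' ⊢
  linarith

omit hf in
theorem _root_.MetricGraph.exists_edge_of_adj {u v : V} (h : M.graph.Adj u v) :
    ∃ e : M.graph.edgeSet, e.1 = s(u, v) ∧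
      ((M.src e = u ∧ M.tgt e = v) ∨ (M.src e = v ∧ M.tgt e = u)) :=
  ⟨⟨s(u, v), h⟩, rfl, by
    have := M.ends ⟨s(u, v), h⟩
    rwa [Sym2.eq_iff] at this⟩

theorem tanh_mul_adj_le {u v : V} (h : M.graph.Adj u v) (T : ℝ) :
    Real.tanh (M.extendEdges M.len s(u, v) + T) * ‖f (.vertex u)‖ ^ 2 ≤
      Real.tanh T * ‖f (.vertex v)‖ ^ 2 + M.extendEdges (edgeEnergy f) s(u, v) := by
  obtain ⟨e, he, ⟨rfl, rfl⟩ | ⟨rfl, rfl⟩⟩ := exists_edge_of_adj h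
  · have := hf.tanh_mul_right_le e ⟨le_rfl, (M.len_pos e).le⟩ T
    rwa [edgePt_of_nonpos le_rfl, sub_zero, ← extendEdges_val M.len,
      ← extendEdges_val (edgeEnergy f), he] at this
  · have := hf.tanh_mul_left_le e ⟨(M.len_pos e).le, le_rfl⟩ T
    rwa [edgePt_of_len_le le_rfl, ← extendEdges_val M.len,
      ← extendEdges_val (edgeEnergy f), he] at this

theorem norm_sub_adj_le {u v : V} (h : M.graph.Adj u v) {δ : ℝ} (hδ : 0 < δ) :
    ‖f (.vertex v) - f (.vertex u)‖ ≤ 2 * δ * M.extendEdges M.len s(u, v) +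
      M.extendEdges (edgeEnergy f) s(u, v) / δ := by
  obtain ⟨e, he, ⟨rfl, rfl⟩ | ⟨rfl, rfl⟩⟩ := exists_edge_of_adj h
  all_goals
    have := hf.norm_sub_src_le e ⟨(M.len_pos e).le, le_rfl⟩ hδ
    rw [edgePt_of_len_le le_rfl, ← extendEdges_val M.len,
      ← extendEdges_val (edgeEnergy f), he] at this
  · exact this
  · rwa [norm_sub_rev]

/-- The trace inequality along a walk. -/
theorem tanh_mul_walk_le {u v : V} (p : M.graph.Walk u v) :
    Real.tanh (p.edges.map (M.extendEdges M.len)).sum * ‖f (.vertex u)‖ ^ 2 ≤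
      (p.edges.map (M.extendEdges (edgeEnergy f))).sum := by
  induction p with
  | nil => simp
  | cons h p ih =>
    simp only [SimpleGraph.Walk.edges_cons, List.map_cons, List.sum_cons]
    have := hf.tanh_mul_adj_le h (p.edges.map (M.extendEdges M.len)).sum
    linarith

theorem norm_sub_walk_le {u v : V} (p : M.graph.Walk u v) {δ : ℝ} (hδ : 0 < δ) :
    ‖f (.vertex v) - f (.vertex u)‖ ≤ 2 * δ * (p.edges.map (M.extendEdges M.len)).sum +
      (p.edges.map (M.extendEdges (edgeEnergy f))).sum / δ := by
  induction p with
  | nil => simp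
  | @cons a b c h p ih =>
    simp only [SimpleGraph.Walk.edges_cons, List.map_cons, List.sum_cons]
    have := hf.norm_sub_adj_le h hδ
    have h3 := norm_sub_le_norm_sub_add_norm_sub (f (.vertex c)) (f (.vertex b)) (f (.vertex a))
    rw [add_div, mul_add]
    linarith

/-- Outside a finite set of edges, the oscillation of `f` on connected subgraphs and on edges is
small. -/
theorem exists_finite_osc_le {ε : ℝ} (hε : 0 < ε) : ∃ K : Set M.graph.edgeSet, K.Finite ∧
    (∀ u v, (M.graph.deleteEdges (Subtype.val '' K)).Reachable u v →
      ‖f (.vertex v) - f (.vertex u)‖ ≤ ε) ∧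
    ∀ e ∉ K, ∀ t ∈ Set.Icc 0 (M.len e), ‖f (M.edgePt e t) - f (.vertex (M.src e))‖ ≤ ε := by
  classical
  obtain ⟨s, hs⟩ := summable_iff_vanishing_norm.1 hf.hasSum_extendEdges.summable ((ε / 4) ^ 2)
    (by positivity)
  refine ⟨Subtype.val ⁻¹' (s : Set (Sym2 V)), s.finite_toSet.preimage Subtype.val_injective.injOn,
    ?_, ?_⟩
  · rintro u v ⟨p₀⟩
    -- A path repeats no edge and avoids `K`, so its energy is a finite subsum of the tail of the
    -- series.
    let p := p₀.bypass
    let q := p.mapLe (M.graph.deleteEdges_le _)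
    have hq : q.edges = p.edges := p.edges_mapLe_eq_edges _
    have hE : (q.edges.map (M.extendEdges (edgeEnergy f))).sum ≤ (ε / 4) ^ 2 := by
      have hnd : p.edges.Nodup := p₀.bypass_isPath.isTrail.edges_nodup
      rw [hq, ← List.sum_toFinset _ hnd]
      refine (le_abs_self _).trans (hs _ ?_).le
      rw [Finset.disjoint_left]
      intro e he hes
      have := p.edges_subset_edgeSet (List.mem_toFinset.1 he)
      rw [SimpleGraph.edgeSet_deleteEdges] at this
      exact this.2 ⟨⟨e, this.1⟩, hes, rfl⟩
    have := norm_sub_le_of_tanh_bounds (E := ℂ) (T := (q.edges.map (M.extendEdges M.len)).sum)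
      (a := f (.vertex u)) (b := f (.vertex v)) (by positivity : 0 < ε / 4)
      (fun δ hδ => (hf.norm_sub_walk_le q hδ).trans (by gcongr))
      ((hf.tanh_mul_walk_le q).trans hE) (by
        have := hf.tanh_mul_walk_le q.reverse
        rw [SimpleGraph.Walk.edges_reverse, List.map_reverse, List.map_reverse, List.sum_reverse,
          List.sum_reverse] at this
        exact this.trans hE)
    linarith
  · intro e he t ht
    have hE : edgeEnergy f e ≤ (ε / 4) ^ 2 := by
      have := hs {e.1} (by simpa using he)
      rw [Finset.sum_singleton, extendEdges_val] at this
      exact (le_abs_self _).trans this.le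
    -- The value at `t` is controlled by `[0, t]`; the value at the initial vertex by the whole
    -- edge, followed by `tanh t ≤ tanh |e|`.
    have hb := hf.tanh_mul_left_le e ht 0
    rw [Real.tanh_zero, zero_mul, zero_add, add_zero] at hb
    have ha : Real.tanh t * ‖f (.vertex (M.src e))‖ ^ 2 ≤ edgeEnergy f e := by
      have := hf.tanh_mul_right_le e ⟨le_rfl, (M.len_pos e).le⟩ 0
      rw [Real.tanh_zero, zero_mul, zero_add, add_zero, sub_zero, edgePt_of_nonpos le_rfl] at this
      exact (mul_le_mul_of_nonneg_right (Real.tanh_monotone ht.2) (sq_nonneg _)).trans this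
    have := norm_sub_le_of_tanh_bounds (E := ℂ) (T := t) (by positivity : 0 < ε / 4)
      (fun δ hδ => (hf.norm_sub_src_le e ht hδ).trans (by gcongr)) (ha.trans hE) (hb.trans hE)
    linarith

theorem sum_edges_le {H : SimpleGraph V} {u v : V} {p : H.Walk u v} (hp : p.IsTrail) :
    (p.edges.map (M.extendEdges (edgeEnergy f))).sum ≤ normH1 f ^ 2 := by
  classical
  rw [← List.sum_toFinset _ hp.edges_nodup]
  exact sum_le_hasSum _ (fun e _ => extendEdges_nonneg (edgeEnergy_nonneg f) e)
    hf.hasSum_extendEdges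

/-- A trail that starts at an end point of an edge without using this edge. -/
theorem tanh_mul_inner_le {e : M.graph.edgeSet} {t : ℝ} (ht : t ∈ Set.Icc 0 (M.len e)) {w : V}
    {a : V} {l : ℝ} (hal : (a = M.src e ∧ l = t) ∨ (a = M.tgt e ∧ l = M.len e - t))
    (q : (M.graph.deleteEdges {e.1}).Walk a w) (hq : q.IsTrail) :
    Real.tanh (l + (q.edges.map (M.extendEdges M.len)).sum) * ‖f (M.edgePt e t)‖ ^ 2 ≤
      normH1 f ^ 2 := by
  classical
  let q' := q.mapLe (M.graph.deleteEdges_le _)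
  have hq' : q'.edges = q.edges := q.edges_mapLe_eq_edges _
  have hwalk := hf.tanh_mul_walk_le q'
  rw [hq'] at hwalk
  -- `q` lives in the graph without `e`, so the energy of `e` may be added to that of `q` without
  -- double counting.
  have hnd : (e.1 :: q.edges).Nodup := by
    refine List.nodup_cons.2 ⟨fun h => ?_, hq.edges_nodup⟩
    have := q.edges_subset_edgeSet h
    rw [SimpleGraph.edgeSet_deleteEdges] at this
    exact this.2 rfl
  have hsum : edgeEnergy f e + (q.edges.map (M.extendEdges (edgeEnergy f))).sum ≤
      normH1 f ^ 2 := by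
    have := sum_le_hasSum (e.1 :: q.edges).toFinset
      (fun e _ => extendEdges_nonneg (edgeEnergy_nonneg f) e) hf.hasSum_extendEdges
    rwa [List.sum_toFinset _ hnd, List.map_cons, List.sum_cons, extendEdges_val] at this
  rcases hal with ⟨rfl, rfl⟩ | ⟨rfl, rfl⟩
  · linarith [hf.tanh_mul_left_le e ht (q.edges.map (M.extendEdges M.len)).sum]
  · linarith [hf.tanh_mul_right_le e ht (q.edges.map (M.extendEdges M.len)).sum]

end MemH1

end MetricGraph

/-! ### The Sobolev inequality -/

namespace SimpleGraph

variable {V : Type*} {G : SimpleGraph V}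

/-- Splitting a walk at an edge. -/
theorem Walk.exists_edges_eq_append {u v : V} (p : G.Walk u v) {e : Sym2 V} (he : e ∈ p.edges) :
    ∃ x y, ∃ p₁ : G.Walk u x, ∃ p₂ : G.Walk y v,
      s(x, y) = e ∧ p.edges = p₁.edges ++ e :: p₂.edges := by
  induction p with
  | nil => simp at he
  | @cons a b c h p ih =>
    rw [edges_cons, List.mem_cons] at he
    rcases he with rfl | he
    · exact ⟨a, b, Walk.nil, p, rfl, by simp⟩
    · obtain ⟨x, y, p₁, p₂, hxy, hp⟩ := ih he
      exact ⟨x, y, Walk.cons h p₁, p₂, hxy, by simp [hp]⟩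

theorem Walk.IsTrail.exists_deleteEdges {u v : V} {p : G.Walk u v} (hp : p.IsTrail)
    {s : Set (Sym2 V)} (h : ∀ e ∈ p.edges, e ∉ s) :
    ∃ q : (G.deleteEdges s).Walk u v, q.IsTrail ∧ q.edges = p.edges := by
  have hq : (p.toDeleteEdges s h).edges = p.edges := p.edges_transfer _
  exact ⟨p.toDeleteEdges s h, ⟨by rw [hq]; exact hp.edges_nodup⟩, hq⟩

end SimpleGraph

theorem Real.continuous_tanh_fun : Continuous Real.tanh := by
  have : Real.tanh = fun x => Real.sinh x / Real.cosh x := funext Real.tanh_eq_sinh_div_cosh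
  rw [this]
  exact Real.continuous_sinh.div Real.continuous_cosh fun x => (Real.cosh_pos x).ne'

namespace MetricGraph

variable {V : Type*} {M : MetricGraph V}

theorem exists_eq_edgePt (e : M.graph.edgeSet) (t : Set.Ioo (0 : ℝ) (M.len e)) :
    ∃ s ∈ Set.Icc 0 (M.len e), (Point.inner e t : M.Point) = M.edgePt e s :=
  ⟨t, Set.Ioo_subset_Icc_self t.2, (edgePt_of_mem_Ioo t.2).symm⟩

namespace MemH1

variable {f : M.Point → ℂ} (hf : MemH1 f)
include hf

/-- If `p` uses `e`, the point cuts `p` into two pieces, and the longer has at least half the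
length. If not, `p` survives the deletion of `e`, an endpoint of `e` is still connected to `p`, and
a half-length trail starts there; the piece of `e` in front only adds length. -/
theorem tanh_mul_edgePt_le (hconn : M.graph.Connected) {e : M.graph.edgeSet} {t : ℝ}
    (ht : t ∈ Set.Icc 0 (M.len e)) {u v : V} {p : M.graph.Walk u v} (hp : p.IsTrail) :
    Real.tanh (M.walkLen p / 2) * ‖f (M.edgePt e t)‖ ^ 2 ≤ normH1 f ^ 2 := by
  have hpos : ∀ e, 0 ≤ M.extendEdges M.len e := extendEdges_nonneg fun e => (M.len_pos e).le
  suffices h : ∃ a l w, ((a = M.src e ∧ l = t) ∨ (a = M.tgt e ∧ l = M.len e - t)) ∧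
      ∃ q : (M.graph.deleteEdges {e.1}).Walk a w, q.IsTrail ∧
        M.walkLen p ≤ 2 * (l + (q.edges.map (M.extendEdges M.len)).sum) by
    obtain ⟨a, l, w, hal, q, hq, hlen⟩ := h
    refine le_trans ?_ (hf.tanh_mul_inner_le ht hal q hq)
    gcongr
    exact Real.tanh_monotone (by linarith)
  rw [walkLen_eq]
  by_cases he : e.1 ∈ p.edges
  · obtain ⟨x, y, p₁, p₂, hxy, hedges⟩ := p.exists_edges_eq_append he
    have hnd := hp.edges_nodup
    rw [hedges, List.nodup_append, List.nodup_cons] at hnd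
    have hsum : (p.edges.map (M.extendEdges M.len)).sum =
        (p₁.edges.map (M.extendEdges M.len)).sum + (M.len e +
          (p₂.edges.map (M.extendEdges M.len)).sum) := by
      rw [hedges, List.map_append, List.sum_append, List.map_cons, List.sum_cons, extendEdges_val]
    obtain ⟨q₁, hq₁, hq₁e⟩ := SimpleGraph.Walk.IsTrail.exists_deleteEdges (p := p₁.reverse)
      (s := {e.1}) (SimpleGraph.Walk.IsTrail.reverse _ ⟨hnd.1⟩) (fun e' he' hee => by
        rw [SimpleGraph.Walk.edges_reverse, List.mem_reverse] at he'
        exact hnd.2.2 _ he' _ List.mem_cons_self hee)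
    obtain ⟨q₂, hq₂, hq₂e⟩ := SimpleGraph.Walk.IsTrail.exists_deleteEdges (p := p₂)
      (s := {e.1}) ⟨hnd.2.1.2⟩ (fun e' he' hee => hnd.2.1.1 (by
        rw [Set.mem_singleton_iff] at hee
        rwa [← hee]))
    have hs₁ : (q₁.edges.map (M.extendEdges M.len)).sum =
        (p₁.edges.map (M.extendEdges M.len)).sum := by
      rw [hq₁e, SimpleGraph.Walk.edges_reverse, List.map_reverse, List.sum_reverse]
    rw [← hq₂e, ← hs₁] at hsum
    rw [← M.ends e, Sym2.eq_iff] at hxy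
    rcases hxy with ⟨rfl, rfl⟩ | ⟨rfl, rfl⟩
    · rcases le_total (t + (q₁.edges.map (M.extendEdges M.len)).sum)
        (M.len e - t + (q₂.edges.map (M.extendEdges M.len)).sum) with h | h
      · exact ⟨_, _, _, Or.inr ⟨rfl, rfl⟩, q₂, hq₂, by linarith⟩
      · exact ⟨_, _, _, Or.inl ⟨rfl, rfl⟩, q₁, hq₁, by linarith⟩
    · rcases le_total (t + (q₂.edges.map (M.extendEdges M.len)).sum)
        (M.len e - t + (q₁.edges.map (M.extendEdges M.len)).sum) with h | h
      · exact ⟨_, _, _, Or.inr ⟨rfl, rfl⟩, q₁, hq₁, by linarith⟩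
      · exact ⟨_, _, _, Or.inl ⟨rfl, rfl⟩, q₂, hq₂, by linarith⟩
  · obtain ⟨p', hp', hp'e⟩ := hp.exists_deleteEdges (s := {e.1}) (fun e' he' hee => by
      rw [Set.mem_singleton_iff] at hee
      exact he (hee ▸ he'))
    have hr := SimpleGraph.reachable_deleteEdges_left_or_right (b := M.tgt e)
      (hconn.preconnected (M.src e) u)
    rw [M.ends e] at hr
    rw [← hp'e]
    rcases hr with hr | hr
    · obtain ⟨w, q, hq, hlen⟩ := SimpleGraph.exists_trail_half_length _ hpos hr p' hp'
      exact ⟨_, _, w, Or.inl ⟨rfl, rfl⟩, q, hq, by linarith [ht.1]⟩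
    · obtain ⟨w, q, hq, hlen⟩ := SimpleGraph.exists_trail_half_length _ hpos hr p' hp'
      exact ⟨_, _, w, Or.inr ⟨rfl, rfl⟩, q, hq, by linarith [ht.2]⟩

theorem tanh_mul_le (hconn : M.graph.Connected) (x : M.Point) {u v : V} {p : M.graph.Walk u v}
    (hp : p.IsTrail) : Real.tanh (M.walkLen p / 2) * ‖f x‖ ^ 2 ≤ normH1 f ^ 2 := by
  cases x with
  | vertex a =>
    obtain ⟨w, q, hq, hlen⟩ := SimpleGraph.exists_trail_half_length (M.extendEdges M.len)
      (extendEdges_nonneg fun e => (M.len_pos e).le) (hconn.preconnected a u) p hp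
    refine le_trans ?_ ((hf.tanh_mul_walk_le q).trans (hf.sum_edges_le hq))
    gcongr
    refine Real.tanh_monotone ?_
    rw [walkLen_eq]
    linarith
  | inner e t =>
    obtain ⟨s, hs, h⟩ := exists_eq_edgePt e t
    rw [h]
    exact hf.tanh_mul_edgePt_le hconn hs hp

theorem tanh_mul_le_of_lt_diam (hconn : M.graph.Connected) (x : M.Point) {y : ℝ}
    (hy : ENNReal.ofReal y < M.diam) : Real.tanh (y / 2) * ‖f x‖ ^ 2 ≤ normH1 f ^ 2 := by
  simp only [diam, lt_iSup_iff] at hy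
  obtain ⟨u, v, p, hp⟩ := hy
  have hlt : y < M.walkLen p.1 := lt_of_not_ge fun h => hp.not_ge (ENNReal.ofReal_le_ofReal h)
  refine le_trans ?_ (hf.tanh_mul_le hconn x p.2.isTrail)
  gcongr
  exact Real.tanh_monotone (by linarith)

/-- The Sobolev inequality. -/
theorem norm_le [Nontrivial V] (hconn : M.graph.Connected) (x : M.Point) :
    ‖f x‖ ≤ M.sobolevConst * normH1 f := by
  have hN : 0 ≤ normH1 f := Real.sqrt_nonneg _
  rw [sobolevConst]
  split_ifs with hd
  · rw [one_mul]
    by_contra! hlt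
    have hA : normH1 f ^ 2 < ‖f x‖ ^ 2 := by gcongr
    have hA0 : 0 < ‖f x‖ ^ 2 := (sq_nonneg _).trans_lt hA
    have hr : normH1 f ^ 2 / ‖f x‖ ^ 2 < 1 := (div_lt_one hA0).2 hA
    have hr0 : 0 ≤ normH1 f ^ 2 / ‖f x‖ ^ 2 := by positivity
    -- `tanh y` is the midpoint between the ratio and 1, so the bound for length `2y` is violated.
    obtain ⟨y, -, hy⟩ := Real.tanh_surjOn
      (show (normH1 f ^ 2 / ‖f x‖ ^ 2 + 1) / 2 ∈ Set.Ioo (-1) 1 from ⟨by linarith, by linarith⟩)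
    have := hf.tanh_mul_le_of_lt_diam hconn x (y := 2 * y) (by rw [hd]; exact ENNReal.ofReal_lt_top)
    rw [show 2 * y / 2 = y by ring, hy] at this
    have h2 : (normH1 f ^ 2 / ‖f x‖ ^ 2 + 1) / 2 * ‖f x‖ ^ 2 =
      (normH1 f ^ 2 + ‖f x‖ ^ 2) / 2 := by
      rw [div_mul_eq_mul_div, add_mul, div_mul_cancel₀ _ hA0.ne', one_mul]
    linarith
  · have hpos : 0 < M.diam.toReal := by
      -- A single edge is a path of positive length.
      refine ENNReal.toReal_pos (fun h0 => ?_) hd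
      obtain ⟨v⟩ := hconn.nonempty
      obtain ⟨w, hw⟩ := hconn.preconnected.exists_adj_of_nontrivial v
      have hp : (SimpleGraph.Walk.cons hw SimpleGraph.Walk.nil).IsPath := by simp [hw.ne]
      have hle : ENNReal.ofReal (M.walkLen (SimpleGraph.Walk.cons hw SimpleGraph.Walk.nil)) ≤
          M.diam := le_iSup_of_le v (le_iSup_of_le w (le_iSup
            (fun p : M.graph.Path v w => ENNReal.ofReal (M.walkLen p.1)) ⟨_, hp⟩))
      rw [h0, nonpos_iff_eq_zero, ENNReal.ofReal_eq_zero, walkLen_eq] at hle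
      simp only [SimpleGraph.Walk.edges_cons, SimpleGraph.Walk.edges_nil, List.map_cons,
        List.map_nil, List.sum_cons, List.sum_nil, add_zero] at hle
      rw [extendEdges_val M.len ⟨s(v, w), hw⟩] at hle
      exact absurd (M.len_pos _) (not_lt.2 hle)
    set D := M.diam.toReal with hD
    -- The supremum need not be attained, hence the limit `y ↑ D`.
    have key : Real.tanh (D / 2) * ‖f x‖ ^ 2 ≤ normH1 f ^ 2 := by
      have hc : Tendsto (fun y => Real.tanh (y / 2) * ‖f x‖ ^ 2) (𝓝[<] D)
          (𝓝 (Real.tanh (D / 2) * ‖f x‖ ^ 2)) :=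
        ((Real.continuous_tanh_fun.comp (continuous_id.div_const 2)).mul
          continuous_const).continuousAt.mono_left nhdsWithin_le_nhds
      refine le_of_tendsto hc ?_
      filter_upwards [self_mem_nhdsWithin] with y hy
      refine hf.tanh_mul_le_of_lt_diam hconn x ?_
      rw [← ENNReal.ofReal_toReal hd]
      exact (ENNReal.ofReal_lt_ofReal_iff hpos).2 hy
    have hs : 0 < Real.sinh (D / 2) := Real.sinh_pos_iff.2 (by linarith)
    have hch := Real.cosh_pos (D / 2)
    refine (abs_le_of_sq_le_sq' ?_ (by positivity)).2
    rw [mul_pow, Real.sq_sqrt (by positivity)]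
    rw [Real.tanh_eq_sinh_div_cosh, div_mul_eq_mul_div, div_le_iff₀ hch] at key
    rw [div_mul_eq_mul_div, le_div_iff₀ hs]
    linarith

end MemH1

end MetricGraph

/-! ### Limits along rays -/

namespace GraphRay

variable {V : Type*} {G : SimpleGraph V}

/-- After deleting finitely many edges, a tail of a ray stays connected. -/
theorem exists_forall_reachable_deleteEdges (R : GraphRay G) {K : Set G.edgeSet} (hK : K.Finite) :
    ∃ N, ∀ n ≥ N, (G.deleteEdges (Subtype.val '' K)).Reachable (R.vert N) (R.vert n) := by
  obtain ⟨N, hN⟩ := R.exists_forall_edge_notMem hK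
  refine ⟨N, fun n hn => ?_⟩
  induction n, hn using Nat.le_induction with
  | base => exact SimpleGraph.Reachable.refl _
  | succ n hn ih =>
    have : (G.deleteEdges (Subtype.val '' K)).Adj (R.vert n) (R.vert (n + 1)) := by
      rw [SimpleGraph.deleteEdges_adj]
      refine ⟨R.adj n, ?_⟩
      rintro ⟨e, he, heq⟩
      exact hN n hn ((Subtype.ext heq : e = R.edge n) ▸ he)
    exact ih.trans this.reachable

theorem tendsto_cofinite_inf_range (R : GraphRay G) {X : Type*} {g : V → X} {l : Filter X}
    (h : Tendsto (fun n => g (R.vert n)) atTop l) :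
    Tendsto g (cofinite ⊓ 𝓟 (Set.range R.vert)) l := by
  intro O hO
  obtain ⟨N, hN⟩ := eventually_atTop.1 (h.eventually hO)
  rw [mem_map, mem_inf_principal, mem_cofinite]
  refine ((Set.finite_lt_nat N).image R.vert).subset ?_
  intro v hv
  simp only [Set.mem_compl_iff, Set.mem_ofPred_eq, Classical.not_imp] at hv
  obtain ⟨⟨n, rfl⟩, hn⟩ := hv
  refine ⟨n, ?_, rfl⟩
  by_contra hlt
  exact hn (hN n (not_lt.1 hlt))

/-- Limits along rays with infinitely many common vertices agree. -/
theorem tendsto_unique_of_infinite {X : Type*} [TopologicalSpace X] [T2Space X] {g : V → X}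
    {R R' : GraphRay G} (hinf : (Set.range R.vert ∩ Set.range R'.vert).Infinite) {L L' : X}
    (h : Tendsto (fun n => g (R.vert n)) atTop (𝓝 L))
    (h' : Tendsto (fun n => g (R'.vert n)) atTop (𝓝 L')) : L = L' := by
  have : (cofinite ⊓ 𝓟 (Set.range R.vert ∩ Set.range R'.vert)).NeBot :=
    cofinite_inf_principal_neBot_iff.2 hinf
  exact tendsto_nhds_unique
    ((R.tendsto_cofinite_inf_range h).mono_left
      (inf_le_inf_left _ (principal_mono.2 Set.inter_subset_left)))
    ((R'.tendsto_cofinite_inf_range h').mono_left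
      (inf_le_inf_left _ (principal_mono.2 Set.inter_subset_right)))

end GraphRay

/-! ### Topological ends and their graph ends -/

namespace MetricGraph

variable {V : Type*} {M : MetricGraph V}

namespace EndSeq

/-- The sequence without its first `n` members. -/
def shift (s : M.EndSeq) (n : ℕ) : M.EndSeq where
  U k := s.U (n + k)
  isOpen k := s.isOpen _
  isConnected k := s.isConnected _
  isCompact_frontier k := s.isCompact_frontier _
  decreasing k := s.decreasing _
  iInter_closure := by
    refine Set.subset_eq_empty (fun z hz => ?_) s.iInter_closure
    rw [Set.mem_iInter] at hz ⊢
    exact fun k => closure_mono (s.antitone (Nat.le_add_left k n)) (hz k)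

theorem Represents.shift {s : M.EndSeq} {γ : M.TopEnd} (h : s.Represents γ) (n : ℕ) :
    (s.shift n).Represents γ := by
  refine Eq.trans (Quotient.sound fun k => ⟨⟨n + k, subset_rfl⟩, ⟨k, ?_⟩⟩) h
  exact s.antitone (Nat.le_add_left k n)

theorem Represents.exists_subset {s s' : M.EndSeq} {γ : M.TopEnd} (h : s.Represents γ)
    (h' : s'.Represents γ) (n : ℕ) : ∃ j, s.U j ⊆ s'.U n :=
  ((Quotient.exact (Eq.trans h h'.symm) : s ≈ s') n).2

theorem exists_represents (γ : M.TopEnd) : ∃ s : M.EndSeq, s.Represents γ := Quotient.exists_rep γ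

/-- Points from the members of a representing sequence converge to the end. -/
theorem Represents.tendsto {s : M.EndSeq} {γ : M.TopEnd} (h : s.Represents γ) {x : ℕ → M.Point}
    (hx : ∀ n, x n ∈ s.U n) :
    Tendsto (fun n => EndCompactification.point (x n)) atTop
      (𝓝 (EndCompactification.topEnd γ : M.EndCompactification)) := by
  rw [TopologicalSpace.tendsto_nhds_generateFrom_iff]
  rintro _ ⟨U, hU, rfl⟩ hγ
  rcases hγ with ⟨y, -, hy⟩ | ⟨γ', ⟨s', hs', hsub⟩, hγ'⟩
  · cases hy
  · cases hγ'
    obtain ⟨j, hj⟩ := h.exists_subset hs' 0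
    filter_upwards [eventually_ge_atTop j] with n hn
    exact Or.inl ⟨x n, hsub (hj (s.antitone hn (hx n))), rfl⟩

/-- The edges that meet the frontier of one of the first members of the sequence. -/
def frontierEdges (s : M.EndSeq) (n : ℕ) : Set M.graph.edgeSet :=
  ⋃ m ∈ Set.Iic n, {e | (M.closedEdge e ∩ frontier (s.U m)).Nonempty}

theorem finite_frontierEdges (hlf : ∀ v, (M.graph.neighborSet v).Finite) (s : M.EndSeq) (n : ℕ) :
    (s.frontierEdges n).Finite :=
  (Set.finite_Iic n).biUnion fun m _ =>
    finite_setOf_closedEdge_inter hlf (s.isCompact_frontier m)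

theorem frontierEdges_mono (s : M.EndSeq) : Monotone s.frontierEdges := fun _ _ h =>
  Set.biUnion_subset_biUnion_left (Set.Iic_subset_Iic.2 h)

theorem closedEdge_subset (s : M.EndSeq) {n : ℕ} {e : M.graph.edgeSet}
    (he : e ∉ s.frontierEdges n) (hne : (M.closedEdge e ∩ s.U n).Nonempty) :
    M.closedEdge e ⊆ s.U n := by
  refine (isPreconnected_closedEdge e).subset_of_disjoint_frontier (s.isOpen n) ?_ hne
  by_contra hdis
  exact he (Set.mem_biUnion Set.self_mem_Iic
    (Set.not_disjoint_iff_nonempty_inter.1 hdis))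

/-- The component containing the end, after deletion of the edges that meet the frontiers of the
first members of the sequence. -/
def comp (s : M.EndSeq) (n : ℕ) : Set V :=
  {v | ∃ m, ∀ x ∈ s.U m,
    (M.graph.deleteEdges (Subtype.val '' s.frontierEdges n)).Reachable v (anchor x)}

theorem comp_antitone (s : M.EndSeq) : Antitone s.comp := by
  rintro n n' h v ⟨m, hm⟩
  exact ⟨m, fun x hx => (hm x hx).mono
    (SimpleGraph.deleteEdges_anti (Set.image_mono (s.frontierEdges_mono h)))⟩

theorem exists_forall_anchor_mem_comp (hlf : ∀ v, (M.graph.neighborSet v).Finite) (s : M.EndSeq)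
    (n : ℕ) : ∃ m₀, ∀ m ≥ m₀, ∀ x ∈ s.U m, anchor x ∈ s.comp n := by
  obtain ⟨m₀, hm₀⟩ := s.exists_forall_disjoint_closedEdge (s.finite_frontierEdges hlf n)
  exact ⟨m₀, fun m hm x hx => ⟨m, fun y hy =>
    reachable_anchor (s.isConnected m).isPreconnected (hm₀ m hm) hx hy⟩⟩

/-- A point far out in the sequence has its anchor in `U n`; membership then spreads along a walk to
`v`, since edges that miss the frontier of `U n` lie wholly inside or outside `U n`. -/
theorem vertex_mem_of_mem_comp (hlf : ∀ v, (M.graph.neighborSet v).Finite) (s : M.EndSeq) {n : ℕ}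
    {v : V} (hv : v ∈ s.comp n) : .vertex v ∈ s.U n := by
  obtain ⟨m, hm⟩ := hv
  obtain ⟨m₀, hm₀⟩ := s.exists_forall_disjoint_closedEdge (s.finite_frontierEdges hlf n)
  -- `m` gives reachability from `v`, `n` containment in `U n`, and `m₀` disjointness from the
  -- deleted edges.
  obtain ⟨x, hx⟩ := (s.isConnected (max m (max n m₀))).nonempty
  have hxn : x ∈ s.U n := s.antitone (le_max_of_le_right (le_max_left _ _)) hx
  have hxa : Point.vertex (anchor x) ∈ s.U n := by
    cases x with
    | vertex w => exact hxn
    | inner e t =>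
      have hxe : Point.inner e t ∈ M.closedEdge e := inner_mem_closedEdge_iff.2 rfl
      refine s.closedEdge_subset (e := e) (fun he => ?_) ⟨_, hxe, hxn⟩
        (vertex_mem_closedEdge_iff.2 (by rw [← M.ends e]; exact Sym2.mem_mk_left _ _))
      exact Set.disjoint_left.1 (hm₀ _ (le_max_of_le_right (le_max_right _ _)) e he) hx hxe
  obtain ⟨p⟩ := (hm x (s.antitone (le_max_left _ _) hx)).symm
  generalize anchor x = a at p hxa
  induction p with
  | nil => exact hxa
  | @cons a b c h p ih =>
    rw [SimpleGraph.deleteEdges_adj] at h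
    have he : (⟨s(a, b), h.1⟩ : M.graph.edgeSet) ∉ s.frontierEdges n :=
      fun he => h.2 ⟨_, he, rfl⟩
    refine ih hm (s.closedEdge_subset he ⟨.vertex a, ?_, hxa⟩ ?_)
    · exact vertex_mem_closedEdge_iff.2 (Sym2.mem_mk_left _ _)
    · exact vertex_mem_closedEdge_iff.2 (Sym2.mem_mk_right _ _)

/-- A ray with tails in all members of the sequence. -/
theorem exists_ray (hlf : ∀ v, (M.graph.neighborSet v).Finite) (s : M.EndSeq) :
    ∃ R : GraphRay M.graph, ∀ n, ∃ N, M.rayCarrier (R.tail N) ⊆ s.U n := by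
  classical
  obtain ⟨R, hR⟩ := SimpleGraph.exists_ray_eventually_mem (G := M.graph) s.comp s.comp_antitone
    (by
      obtain ⟨m, hm⟩ := s.exists_forall_anchor_mem_comp hlf 0
      obtain ⟨x, hx⟩ := (s.isConnected m).nonempty
      exact ⟨_, hm m le_rfl x hx⟩)
    (fun v => by
      by_contra! hv
      have : Point.vertex v ∈ ⋂ n, closure (s.U n) :=
        Set.mem_iInter.2 fun n => subset_closure (s.vertex_mem_of_mem_comp hlf (hv n))
      rwa [s.iInter_closure] at this)
    (by
      rintro n v ⟨m, hm⟩
      obtain ⟨m₀, hm₀⟩ := s.exists_forall_anchor_mem_comp hlf (n + 1)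
      obtain ⟨x, hx⟩ := (s.isConnected (max m m₀)).nonempty
      obtain ⟨p⟩ := hm x (s.antitone (le_max_left _ _) hx)
      refine ⟨_, hm₀ _ (le_max_right _ _) x hx, p.mapLe (M.graph.deleteEdges_le _),
        fun y hy => ?_⟩
      rw [SimpleGraph.Walk.support_mapLe_eq_support] at hy
      exact ⟨m, fun z hz => (p.takeUntil y hy).reachable.symm.trans (hm z hz)⟩)
  refine ⟨R, fun n => ?_⟩
  obtain ⟨N₁, hN₁⟩ := hR n
  obtain ⟨N₂, hN₂⟩ := R.exists_forall_edge_notMem (s.finite_frontierEdges hlf n)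
  -- Beyond `N₁` the vertices lie in `U n`; beyond `N₂` the edges miss its frontier.
  refine ⟨max N₁ N₂, Set.iUnion_subset fun k => ?_⟩
  refine s.closedEdge_subset (e := R.edge (max N₁ N₂ + k)) (hN₂ _ (by omega))
    ⟨.vertex (R.vert (max N₁ N₂ + k)), vertex_mem_closedEdge_iff.2 (Sym2.mem_mk_left _ _),
      s.vertex_mem_of_mem_comp hlf (hN₁ _ (by omega))⟩

end EndSeq

theorem exists_corresponds (hlf : ∀ v, (M.graph.neighborSet v).Finite) (γ : M.TopEnd) :
    ∃ ω : GraphEnd M.graph, M.Corresponds γ ω := by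
  obtain ⟨s, hs⟩ := EndSeq.exists_represents γ
  obtain ⟨R, hR⟩ := s.exists_ray hlf
  refine ⟨Quot.mk _ R, fun s' hs' n => ?_⟩
  obtain ⟨j, hj⟩ := hs.exists_subset hs' n
  obtain ⟨N, hN⟩ := hR j
  exact ⟨R.tail N, Quot.sound (R.equivalent_tail N), hN.trans hj⟩

theorem vertex_mem_rayCarrier (R : GraphRay M.graph) (n : ℕ) :
    .vertex (R.vert n) ∈ M.rayCarrier R :=
  Set.mem_iUnion.2 ⟨n, vertex_mem_closedEdge_iff.2 (Sym2.mem_mk_left _ _)⟩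

/-! ### Boundary values and continuous extension -/

/-- `L` is the limit of `f` at the end `γ`. -/
def EndLimit (f : M.Point → ℂ) (γ : M.TopEnd) (L : ℂ) : Prop :=
  ∀ s : M.EndSeq, s.Represents γ → ∀ ε > 0, ∃ n, ∀ x ∈ s.U n, ‖f x - L‖ ≤ ε

/-- At an end, bounds for `f` on a neighbourhood carry over to the limit. -/
theorem EndLimit.norm_sub_le {f : M.Point → ℂ} {γ : M.TopEnd} {L : ℂ} (h : EndLimit f γ L)
    {s : M.EndSeq} (hs : s.Represents γ) {c : ℂ} {r : ℝ} {n : ℕ}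
    (hr : ∀ x ∈ s.U n, ‖f x - c‖ ≤ r) : ‖L - c‖ ≤ r := by
  refine le_of_forall_pos_le_add fun ε hε => ?_
  obtain ⟨m, hm⟩ := h s hs ε hε
  obtain ⟨x, hx⟩ := (s.isConnected (max n m)).nonempty
  have h1 := hr x (s.antitone (le_max_left _ _) hx)
  have h2 := hm x (s.antitone (le_max_right _ _) hx)
  have h3 := norm_sub_le_norm_sub_add_norm_sub L (f x) c
  rw [norm_sub_rev L (f x)] at h3
  linarith

namespace MemH1

variable {f : M.Point → ℂ} (hf : MemH1 f)
include hf

/-- Compare `x` with its anchor along an edge, the two anchors inside one component, and the second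
anchor with `y`: three times `ε / 3`. -/
theorem exists_finite_osc_le_of_isPreconnected {ε : ℝ} (hε : 0 < ε) :
    ∃ K : Set M.graph.edgeSet, K.Finite ∧ ∀ U : Set M.Point, IsPreconnected U →
      (∀ e ∈ K, Disjoint U (M.closedEdge e)) → ∀ x ∈ U, ∀ y ∈ U, ‖f x - f y‖ ≤ ε := by
  obtain ⟨K, hK, hr, he⟩ := hf.exists_finite_osc_le (show 0 < ε / 3 by linarith)
  refine ⟨K, hK, fun U hU hUK x hx y hy => ?_⟩
  have ha : ∀ z ∈ U, ‖f z - f (.vertex (anchor z))‖ ≤ ε / 3 := by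
    intro z hz
    cases z with
    | vertex v => simpa [anchor] using (show 0 ≤ ε / 3 by linarith)
    | inner e t =>
      obtain ⟨s, hs, h⟩ := exists_eq_edgePt e t
      have heK : e ∉ K := fun h' =>
        Set.disjoint_left.1 (hUK e h') hz (inner_mem_closedEdge_iff.2 rfl)
      have := he e heK s hs
      rwa [← h] at this
  have h1 := ha x hx
  have h2 := ha y hy
  have h3 := hr _ _ (reachable_anchor hU hUK hy hx)
  have h4 := norm_sub_le_norm_sub_add_norm_sub (f x) (f (.vertex (anchor x))) (f y)
  have h5 := norm_sub_le_norm_sub_add_norm_sub (f (.vertex (anchor x)))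
    (f (.vertex (anchor y))) (f y)
  rw [norm_sub_rev (f y)] at h2
  linarith

theorem exists_endLimit (γ : M.TopEnd) : ∃ L, EndLimit f γ L := by
  obtain ⟨s, hs⟩ := EndSeq.exists_represents γ
  have hosc : ∀ ε > 0, ∃ n, ∀ x ∈ s.U n, ∀ y ∈ s.U n, ‖f x - f y‖ ≤ ε := by
    intro ε hε
    obtain ⟨K, hK, h⟩ := hf.exists_finite_osc_le_of_isPreconnected hε
    obtain ⟨n, hn⟩ := s.exists_forall_disjoint_closedEdge hK
    exact ⟨n, h _ (s.isConnected n).isPreconnected (hn n le_rfl)⟩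
  choose x hx using fun n => (s.isConnected n).nonempty
  have hcau : CauchySeq fun n => f (x n) := by
    rw [Metric.cauchySeq_iff']
    intro ε hε
    obtain ⟨n, hn⟩ := hosc (ε / 2) (by linarith)
    refine ⟨n, fun m hm => ?_⟩
    rw [dist_eq_norm]
    linarith [hn _ (s.antitone hm (hx m)) _ (hx n)]
  obtain ⟨L, hL⟩ := cauchySeq_tendsto_of_complete hcau
  refine ⟨L, fun s' hs' ε hε => ?_⟩
  obtain ⟨n, hn⟩ := hosc ε hε
  obtain ⟨j, hj⟩ := hs'.exists_subset hs n
  refine ⟨j, fun y hy => le_of_tendsto (tendsto_const_nhds.sub hL).norm ?_⟩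
  filter_upwards [eventually_ge_atTop n] with m hm
  exact hn y (hj hy) _ (s.antitone hm (hx m))

theorem exists_tendsto_ray (R : GraphRay M.graph) :
    ∃ L, Tendsto (fun n => f (.vertex (R.vert n))) atTop (𝓝 L) := by
  refine cauchySeq_tendsto_of_complete ?_
  rw [Metric.cauchySeq_iff']
  intro ε hε
  obtain ⟨K, hK, hr, -⟩ := hf.exists_finite_osc_le (show 0 < ε / 2 by linarith)
  obtain ⟨N, hN⟩ := R.exists_forall_reachable_deleteEdges hK
  refine ⟨N, fun n hn => ?_⟩
  rw [dist_eq_norm]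
  linarith [hr _ _ (hN n hn)]

theorem tendsto_of_equivalent {R R' : GraphRay M.graph} (h : R.Equivalent R') {L : ℂ}
    (hL : Tendsto (fun n => f (.vertex (R.vert n))) atTop (𝓝 L)) :
    Tendsto (fun n => f (.vertex (R'.vert n))) atTop (𝓝 L) := by
  obtain ⟨R₃, h₁, h₂⟩ := h
  obtain ⟨L₃, h₃⟩ := hf.exists_tendsto_ray R₃
  obtain ⟨L', hL'⟩ := hf.exists_tendsto_ray R'
  have e₁ : L₃ = L := GraphRay.tendsto_unique_of_infinite (g := fun v => f (.vertex v)) h₁ h₃ hL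
  have e₂ : L₃ = L' := GraphRay.tendsto_unique_of_infinite (g := fun v => f (.vertex v)) h₂ h₃ hL'
  rwa [← e₁, e₂]

/-- The limit along a ray depends on the graph end only. -/
theorem tendsto_iff_of_belongsTo {R R' : GraphRay M.graph} {ω : GraphEnd M.graph}
    (h : R.BelongsTo ω) (h' : R'.BelongsTo ω) (L : ℂ) :
    Tendsto (fun n => f (.vertex (R.vert n))) atTop (𝓝 L) ↔
      Tendsto (fun n => f (.vertex (R'.vert n))) atTop (𝓝 L) := by
  -- Equality in the quotient yields a chain of equivalent rays, along which the limit is passed on.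
  have hgen := Quot.eqvGen_exact (Eq.trans h h'.symm)
  clear h h'
  induction hgen with
  | rel R R' h =>
    refine ⟨hf.tendsto_of_equivalent h, hf.tendsto_of_equivalent ?_⟩
    obtain ⟨R₃, h₁, h₂⟩ := h
    exact ⟨R₃, h₂, h₁⟩
  | refl => exact Iff.rfl
  | symm _ _ _ ih => exact ih.symm
  | trans _ _ _ _ _ ih₁ ih₂ => exact ih₁.trans ih₂

/-- All rays of `ω` share one limit, and some ray of `ω` lies in a set `U n` on which `f` is within
`ε` of `L`. -/
theorem tendsto_of_corresponds {γ : M.TopEnd} {L : ℂ} (hL : EndLimit f γ L)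
    {ω : GraphEnd M.graph} (hω : M.Corresponds γ ω) {R : GraphRay M.graph}
    (hR : R.BelongsTo ω) : Tendsto (fun n => f (.vertex (R.vert n))) atTop (𝓝 L) := by
  obtain ⟨L', hL'⟩ := hf.exists_tendsto_ray R
  suffices h : L' = L by rwa [← h]
  rw [← sub_eq_zero, ← norm_le_zero_iff]
  refine le_of_forall_pos_le_add fun ε hε => ?_
  rw [zero_add]
  obtain ⟨s, hs⟩ := EndSeq.exists_represents γ
  obtain ⟨n, hn⟩ := hL s hs ε hε
  obtain ⟨R', hR', hsub⟩ := hω s hs n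
  have h' := (hf.tendsto_iff_of_belongsTo hR hR' L').1 hL'
  exact le_of_tendsto (h'.sub_const L).norm
    (Eventually.of_forall fun k => hn _ (hsub (vertex_mem_rayCarrier R' k)))

end MemH1

/-- Extension of a function by prescribed values at the ends. -/
def extendToEnds (f : M.Point → ℂ) (L : M.TopEnd → ℂ) : M.EndCompactification → ℂ
  | .point x => f x
  | .topEnd γ => L γ

theorem continuous_extendToEnds {f : M.Point → ℂ} (hf : Continuous f) {L : M.TopEnd → ℂ}
    (hL : ∀ γ, EndLimit f γ (L γ)) : Continuous (extendToEnds f L) := by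
  rw [continuous_iff_continuousAt]
  intro z
  rw [ContinuousAt, Metric.nhds_basis_closedBall.tendsto_right_iff]
  intro ε hε
  -- Control on `U` is enough: the values at the ends in `M.hat U` are limits of values on `U`.
  suffices h : ∃ U : Set M.Point, IsOpen U ∧ z ∈ M.hat U ∧
      ∀ x ∈ U, ‖f x - extendToEnds f L z‖ ≤ ε by
    obtain ⟨U, hU, hzU, hUε⟩ := h
    have hopen : IsOpen (M.hat U) := TopologicalSpace.isOpen_generateFrom_of_mem ⟨U, hU, rfl⟩
    filter_upwards [hopen.mem_nhds hzU] with y hy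
    rw [mem_closedBall_iff_norm]
    rcases hy with ⟨x, hx, rfl⟩ | ⟨γ, ⟨s, hs, hsub⟩, rfl⟩
    · exact hUε x hx
    · exact (hL γ).norm_sub_le hs (n := 0) fun x hx => hUε x (hsub hx)
  cases z with
  | point x =>
    refine ⟨f ⁻¹' Metric.ball (f x) ε, Metric.isOpen_ball.preimage hf,
      Or.inl ⟨x, Metric.mem_ball_self hε, rfl⟩, fun y hy => ?_⟩
    exact (mem_ball_iff_norm.1 hy).le
  | topEnd γ =>
    obtain ⟨s, hs⟩ := EndSeq.exists_represents γ
    obtain ⟨n, hn⟩ := hL γ s hs ε hε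
    -- The definition of `hat` asks for the first member of a sequence inside `U`, hence the shift.
    exact ⟨s.U n, s.isOpen n, Or.inr ⟨γ, ⟨s.shift n, hs.shift n, subset_rfl⟩, rfl⟩, hn⟩

/-- A continuous function on the end compactification is determined by its values on the graph. -/
theorem eq_of_continuous_of_eqOn_points {F F' : M.EndCompactification → ℂ} (hF : Continuous F)
    (hF' : Continuous F') (h : ∀ x, F (.point x) = F' (.point x)) : F = F' := by
  funext z
  cases z with
  | point x => exact h x
  | topEnd γ =>
    obtain ⟨s, hs⟩ := EndSeq.exists_represents γ
    choose x hx using fun n => (s.isConnected n).nonempty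
    have h1 := (hF.tendsto _).comp (hs.tendsto hx)
    have h2 := (hF'.tendsto _).comp (hs.tendsto hx)
    refine tendsto_nhds_unique h1 (h2.congr fun n => (h _).symm)

end MetricGraph

/-! ### The theorem -/

theorem proposition3p4 {V : Type*} [Countable V] [Infinite V] (M : MetricGraph V)
    (hconn : M.graph.Connected) (hlf : ∀ v, (M.graph.neighborSet v).Finite)
    (f : M.Point → ℂ) (hf : MetricGraph.MemH1 f) :
    ∃ F : M.EndCompactification → ℂ,
      -- `F` is a continuous extension of `f`, and the only one
      (Continuous F ∧ ∀ x, F (.point x) = f x) ∧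
      (∀ F' : M.EndCompactification → ℂ,
        (Continuous F' ∧ ∀ x, F' (.point x) = f x) → F' = F) ∧
      -- its boundary values are the limits along the rays of the corresponding graph end
      (∀ γ : M.TopEnd,
        (∃ ω : GraphEnd M.graph, M.Corresponds γ ω) ∧
        ∀ ω : GraphEnd M.graph, M.Corresponds γ ω →
          ∀ R : GraphRay M.graph, R.BelongsTo ω →
            Tendsto (fun n => f (.vertex (R.vert n))) atTop (𝓝 (F (.topEnd γ)))) ∧
      -- the supremum norms of `f` and `F` agree and obey the Sobolev bound
      BddAbove (Set.range fun z => ‖F z‖) ∧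
      (⨆ x : M.Point, ‖f x‖) = (⨆ z : M.EndCompactification, ‖F z‖) ∧
      (⨆ z : M.EndCompactification, ‖F z‖) ≤ M.sobolevConst * MetricGraph.normH1 f := by
  choose L hL using hf.exists_endLimit
  let F := MetricGraph.extendToEnds f L
  have hFc : Continuous F := MetricGraph.continuous_extendToEnds hf.continuous hL
  have hext : ∀ r, (∀ x, ‖f x‖ ≤ r) → ∀ z, ‖F z‖ ≤ r := by
    rintro r hr (x | γ)
    · exact hr x
    · obtain ⟨s, hs⟩ := MetricGraph.EndSeq.exists_represents γ
      have := (hL γ).norm_sub_le hs (c := 0) (n := 0) fun x _ => by simpa using hr x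
      rwa [sub_zero] at this
  have hbound := hext _ (hf.norm_le hconn)
  have hbdd : BddAbove (Set.range fun z => ‖F z‖) := ⟨_, Set.forall_mem_range.2 hbound⟩
  have hbddf : BddAbove (Set.range fun x => ‖f x‖) :=
    ⟨_, Set.forall_mem_range.2 (hf.norm_le hconn)⟩
  obtain ⟨v⟩ := hconn.nonempty
  have : Nonempty M.Point := ⟨.vertex v⟩
  have : Nonempty M.EndCompactification := ⟨.point (.vertex v)⟩
  refine ⟨F, ⟨hFc, fun x => rfl⟩, fun F' hF' => ?_, fun γ => ?_, hbdd, ?_, ciSup_le hbound⟩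
  · exact MetricGraph.eq_of_continuous_of_eqOn_points hF'.1 hFc fun x => hF'.2 x
  · exact ⟨MetricGraph.exists_corresponds hlf γ,
      fun ω hω R hR => hf.tendsto_of_corresponds (hL γ) hω hR⟩
  · refine le_antisymm (ciSup_le fun x => ?_) (ciSup_le (hext _ (le_ciSup hbddf)))
    exact le_ciSup hbdd (.point x)
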